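/- Let $\Sigma$ be a finite, non-empty, totally ordered alphabet and let $w\ge 1$ be an integer. A $(\Sigma,w)$-layer is a tuple $B=(\ell,r,T,I,F,\iota,\phi)$ with left states $\ell\subseteq\{0,\dots,w-1\}$, right states $r\subseteq\{0,\dots,w-1\}$, transitions $T\subseteq \ell\times\Sigma\times r$, initial states $I\subseteq \ell$, final states $F\subseteq r$ and flags $\iota,\phi\in\{0,1\}$ such that $I=\emptyset$ if $\iota=0$ and $F=\emptyset$ if $\phi=0$. Let $\mathcal{B}(\Sigma,w)$ be the set of all $(\Sigma,w)$-layers. A layer is deterministic if $\iota=1$ implies $I=\ell$ and $|\ell|=1$, and every $(p,a)\in \ell\times\Sigma$ has at most one transition $(p,a,q)\in T$; it is complete if $\iota=1$ implies $I\ne\emptyset$, and every $(p,a)\in \ell\times\Sigma$ has at least one transition. Let $\widehat{\mathcal{B}}(\Sigma,w)$ be the set of deterministic, complete $(\Sigma,w)$-layers. A $(\Sigma,w)$-ODD of length $k\ge1$ is a string $D=B_1\cdots B_k$ of $(\Sigma,w)$-layers such that $\ell(B_{i+1})=r(B_i)$ for $1\le i<k$, $\iota(B_i)=1$ iff $i=1$,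 and $\phi(B_i)=1$ iff $i=k$. It is deterministic (complete) if all its layers are. Its language is the pair $\mathcal{L}(D)=(k,L)$, where $L$ is the set of all $a_1\cdots a_k\in\Sigma^k$ for which there are states $p_0,\dots,p_k$ with $p_0\in I(B_1)$, $(p_{i-1},a_i,p_i)\in T(B_i)$ for all $i$, and $p_k\in F(B_k)$. Its number of states is $|\ell(B_1)|+\sum_{i}|r(B_i)|$. A deterministic, complete ODD is minimized if no deterministic, complete ODD of any width with the same language has fewer states. A layer is normalized if it is deterministic, $\ell=\{0,\dots,w_1-1\}$ and $r=\{0,\dots,w_2-1\}$ for some $w_1,w_2\ge1$, every right state has an incoming transition, and for all $q,q'\in r$ one has $q<q'$ iff $\xi(q)<\xi(q')$, where $\xi(q)$ is the lexicographically least pair $(p,a)$ with $(p,a,q)\in T$; an ODD is normalized if all its layers are. A canonical form of an ODD $D$ is a deterministic, complete, minimized, normalized ODD with the same language as $D$. For sets of symbols $S_1,S_2$, an $(S_1,S_2)$-transduction is a set of pairs $(s,t)\in S_1^+\times S_2^+$ with $|s|=|t|$. It is functional if each $s$ occurs in at most one pair $(s,t)$, and it is $n$-regular if some nondeterministic finite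 automaton over $S_1\times S_2$ with at most $n$ states accepts exactly the strings $s\otimes t=(s_1,t_1)\cdots(s_k,t_k)$ for $(s,t)$ in the transduction. Theorem. Every $(\Sigma,w)$-ODD $D$ has exactly one canonical form $\mathcal{C}(D)$, and there is an absolute constant $c$ (independent of $\Sigma$ and $w$) such that the following hold. 1. $\{(D,\mathcal{C}(D)) : D \text{ a } (\Sigma,w)\text{-ODD}\}$ is a functional $(\mathcal{B}(\Sigma,w),\widehat{\mathcal{B}}(\Sigma,2^w))$-transduction that is $n$-regular for some $n\le 2^{c\,|\Sigma|\,w\,2^w}$. 2. $\{(D,\mathcal{C}(D)) : D \text{ a deterministic, complete } (\Sigma,w)\text{-ODD}\}$ is a functional $(\widehat{\mathcal{B}}(\Sigma,w),\widehat{\mathcal{B}}(\Sigma,w))$-transduction that is $n$-regular for some $n\le 2^{c\,|\Sigma|\,w\,\log_2\max(w,2)}$. -/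

import Mathlib

namespace ODD

universe u v

/-! ### Layers -/

/-- A layer over the alphabet `A`: left and right states, labelled transitions, initial and
final states, and the two Boolean flags. States are natural numbers; the width restriction is
imposed by `layers`. -/
@[ext]
structure Layer (A : Type u) where
  left : Finset ℕ
  right : Finset ℕ
  trans : Finset (ℕ × A × ℕ)
  init : Finset ℕ
  final : Finset ℕ
  initFlag : Bool
  finalFlag : Bool
  trans_mem : ∀ p a q, (p, a, q) ∈ trans → p ∈ left ∧ q ∈ right
  init_subset : init ⊆ left
  final_subset : final ⊆ right
  init_eq_empty : initFlag = false → init = ∅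
  final_eq_empty : finalFlag = false → final = ∅

variable {A : Type u}

namespace Layer

def IsDeterministic (L : Layer A) : Prop :=
  (L.initFlag = true → L.init = L.left ∧ L.left.card = 1) ∧
  ∀ p ∈ L.left, ∀ a : A, ∀ q ∈ L.right, ∀ q' ∈ L.right,
    (p, a, q) ∈ L.trans → (p, a, q') ∈ L.trans → q = q'

def IsComplete (L : Layer A) : Prop :=
  (L.initFlag = true → L.init ≠ ∅) ∧
  ∀ p ∈ L.left, ∀ a : A, ∃ q ∈ L.right, (p, a, q) ∈ L.trans

def IsReachable (L : Layer A) : Prop :=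
  ∀ q ∈ L.right, ∃ a : A, ∃ p ∈ L.left, (p, a, q) ∈ L.trans

/-- The pairs `(p, a)`, ordered lexicographically, with a transition `(p, a, q)`. -/
def incoming (L : Layer A) (q : ℕ) : Set (ℕ ×ₗ A) :=
  {x | ((ofLex x).1, (ofLex x).2, q) ∈ L.trans}

/-- Reachable, deterministic, and right states are ordered as their lexicographically least
incoming pairs `(p, a)`. -/
def IsWellOrdered [LinearOrder A] (L : Layer A) : Prop :=
  L.IsReachable ∧ L.IsDeterministic ∧
  ∀ q ∈ L.right, ∀ q' ∈ L.right, ∀ x x' : ℕ ×ₗ A,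
    IsLeast (L.incoming q) x → IsLeast (L.incoming q') x' → (q < q' ↔ x < x')

def IsContiguous (L : Layer A) : Prop :=
  ∃ w₁ w₂ : ℕ, 1 ≤ w₁ ∧ 1 ≤ w₂ ∧ L.left = Finset.range w₁ ∧ L.right = Finset.range w₂

def IsNormalized [LinearOrder A] (L : Layer A) : Prop :=
  L.IsWellOrdered ∧ L.IsContiguous

end Layer

/-- The alphabet of all layers of width at most `w`: the states lie in `{0, …, w - 1}`. -/
def layers (A : Type u) (w : ℕ) : Set (Layer A) :=
  {L | L.left ⊆ Finset.range w ∧ L.right ⊆ Finset.range w}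

/-- The alphabet of all deterministic, complete layers of width at most `w`. -/
def cdLayers (A : Type u) (w : ℕ) : Set (Layer A) :=
  {L | L ∈ layers A w ∧ L.IsDeterministic ∧ L.IsComplete}

/-! ### Ordered decision diagrams -/

/-- A nonempty string of layers is an ODD if consecutive frontiers agree, exactly the first layer
has its initial flag set, and exactly the last layer has its final flag set. -/
def IsODD (D : List (Layer A)) : Prop :=
  D ≠ [] ∧
  (∀ (i : ℕ) (h : i + 1 < D.length), (D[i + 1]).left = (D[i]).right) ∧
  (∀ (i : ℕ) (h : i < D.length), (D[i]).initFlag = true ↔ i = 0) ∧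
  (∀ (i : ℕ) (h : i < D.length), (D[i]).finalFlag = true ↔ i + 1 = D.length)

/-- The set of all ODDs of width at most `w`. -/
def odds (A : Type u) (w : ℕ) : Set (List (Layer A)) :=
  {D | IsODD D ∧ ∀ L ∈ D, L ∈ layers A w}

/-- The set of all deterministic, complete ODDs of width at most `w`. -/
def cdOdds (A : Type u) (w : ℕ) : Set (List (Layer A)) :=
  {D | IsODD D ∧ ∀ L ∈ D, L ∈ cdLayers A w}

/-- `D` accepts `s` if there is a sequence of states `p 0, …, p k`, with `k` the common length of
`D` and `s`, from an initial to a final state, following transitions labelled by `s`. -/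
def Accepts (D : List (Layer A)) (s : List A) : Prop :=
  ∃ (hs : s.length = D.length) (hD : D ≠ []) (p : ℕ → ℕ),
    p 0 ∈ (D.head hD).init ∧
    (∀ (i : ℕ) (h : i < D.length), (p i, s[i]'(hs ▸ h), p (i + 1)) ∈ (D[i]).trans) ∧
    p D.length ∈ (D.getLast hD).final

/-- The length-typed language of an ODD. -/
def lang (D : List (Layer A)) : ℕ × Set (List A) :=
  (D.length, {s | Accepts D s})

/-- The number of left states of the first layer plus the numbers of right states of all layers. -/
def numStates (D : List (Layer A)) : ℕ :=
  (D.head?.elim 0 fun L => L.left.card) + (D.map fun L => L.right.card).sum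

/-- `D` has the least number of states among all deterministic, complete ODDs, of any width, with
the same language. -/
def IsMinimized (D : List (Layer A)) : Prop :=
  ∀ w : ℕ, 1 ≤ w → ∀ D' ∈ cdOdds A w, lang D' = lang D → numStates D ≤ numStates D'

/-- `C` is a canonical form of `D`: a deterministic, complete, minimized, normalized ODD (of
whatever width) with the same language as `D`. -/
def IsCanonicalForm [LinearOrder A] (D C : List (Layer A)) : Prop :=
  IsODD C ∧ (∀ L ∈ C, L.IsDeterministic) ∧ (∀ L ∈ C, L.IsComplete) ∧
  IsMinimized C ∧ (∀ L ∈ C, L.IsNormalized) ∧ lang C = lang D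

/-! ### Finite automata and transductions -/

/-- The language `K` over the alphabet `S` is accepted by a nondeterministic finite automaton over
`S` with at most `n` states. -/
def IsRegularLang {α : Type u} (S : Set α) (n : ℕ) (K : Language α) : Prop :=
  ∃ (Q : Type) (_ : Fintype Q) (M : NFA α Q),
    Fintype.card Q ≤ n ∧ (∀ q a, (M.step q a).Nonempty → a ∈ S) ∧ M.accepts = K

/-- A length-preserving relation between nonempty strings over `S₁` and over `S₂`. -/
def IsTransduction {α : Type u} {β : Type v} (S₁ : Set α) (S₂ : Set β)
    (T : Set (List α × List β)) : Prop :=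
  ∀ x ∈ T, x.1 ≠ [] ∧ x.2 ≠ [] ∧ x.1.length = x.2.length ∧
    (∀ a ∈ x.1, a ∈ S₁) ∧ ∀ b ∈ x.2, b ∈ S₂

def IsFunctional {α : Type u} {β : Type v} (T : Set (List α × List β)) : Prop :=
  ∀ s t t', (s, t) ∈ T → (s, t') ∈ T → t = t'

def dom {α : Type u} {β : Type v} (T : Set (List α × List β)) : Set (List α) :=
  {s | ∃ t, (s, t) ∈ T}

/-- The language of all tensor products `s ⊗ t` with `(s, t) ∈ T`. -/
def tensorLang {α : Type u} {β : Type v} (T : Set (List α × List β)) : Language (α × β) :=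
  {z | ∃ x ∈ T, z = x.1.zip x.2}

/-- `T` is an `n`-regular `(S₁, S₂)`-transduction. -/
def IsRegularTransduction {α : Type u} {β : Type v} (S₁ : Set α) (S₂ : Set β) (n : ℕ)
    (T : Set (List α × List β)) : Prop :=
  IsTransduction S₁ S₂ T ∧ IsRegularLang (S₁ ×ˢ S₂) n (tensorLang T)

/-- The pairs `(D, C)` with `D` an ODD of width at most `w` and `C` its canonical form. -/
def canonization (A : Type u) [LinearOrder A] (w : ℕ) :
    Set (List (Layer A) × List (Layer A)) :=
  {x | x.1 ∈ odds A w ∧ IsCanonicalForm x.1 x.2}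

/-- The pairs `(D, C)` with `D` a deterministic, complete ODD of width at most `w` and `C` its
canonical form. -/
def cdCanonization (A : Type u) [LinearOrder A] (w : ℕ) :
    Set (List (Layer A) × List (Layer A)) :=
  {x | x.1 ∈ cdOdds A w ∧ IsCanonicalForm x.1 x.2}

end ODD

/-! Call a layer reduced if its left states are told apart by their outgoing transitions and, in a
last layer, its right states by being final. By backward induction, two states at the same level of
a reduced ODD that accept the same suffixes are equal, so the state a word leads to in a reduced ODD
is a function of the set of states it leads to in any equivalent ODD. Hence a reduced ODD whose
states are all accessible is minimized, and conversely every minimized ODD is, up to the names of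
its states, the same as any equivalent reduced one. In a normalized ODD the least incoming pairs fix
the names level by level, which gives uniqueness. Numbering the residuals of the language in this
way gives existence.

Being canonical has thus become a condition on single layers, up to the equality of the languages. A
nondeterministic automaton reading `D` and `C` in parallel guesses, at each level, the partial
function from the reachable sets of states of `D` to the states of `C`, and checks it layer by
layer. There are at most `2 ^ w` such sets, and at most `w` if `D` is deterministic and complete. -/

namespace ODD

universe u v

variable {A : Type u}

/-! ### Sequences of layers -/

instance : Inhabited (Layer A) :=
  ⟨⟨∅, ∅, ∅, ∅, ∅, false, false, by simp, by simp, by simp, by simp, by simp⟩⟩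

/-- The layers of `D` as an infinite sequence, padded with empty layers. -/
def seq (D : List (Layer A)) (i : ℕ) : Layer A := D.getD i default

theorem seq_eq_getElem (D : List (Layer A)) {i : ℕ} (h : i < D.length) : seq D i = D[i] :=
  (List.getElem_eq_getD default).symm

theorem forall_mem_iff_seq {D : List (Layer A)} {P : Layer A → Prop} :
    (∀ L ∈ D, P L) ↔ ∀ i < D.length, P (seq D i) := by
  rw [List.forall_mem_iff_forall_getElem]
  exact forall₂_congr fun i hi => by rw [seq_eq_getElem D hi]

theorem ext_seq {D D' : List (Layer A)} (hl : D.length = D'.length)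
    (h : ∀ i < D.length, seq D i = seq D' i) : D = D' :=
  List.ext_getElem hl fun i h₁ h₂ => by rw [← seq_eq_getElem, ← seq_eq_getElem, h i h₁]

theorem seq_map_range (B : ℕ → Layer A) {k i : ℕ} (hi : i < k) :
    seq ((List.range k).map B) i = B i := by
  rw [seq_eq_getElem _ (by simpa using hi), List.getElem_map, List.getElem_range]

theorem map_seq_range (D : List (Layer A)) : (List.range D.length).map (seq D) = D :=
  ext_seq (by simp) fun _ hi => seq_map_range _ (by simpa using hi)

/-- The first `k` members of a sequence of layers form an ODD. -/
structure IsODDSeq (B : ℕ → Layer A) (k : ℕ) : Prop where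
  pos : 0 < k
  left_succ : ∀ i, i + 1 < k → (B (i + 1)).left = (B i).right
  initFlag : ∀ i < k, ((B i).initFlag = true ↔ i = 0)
  finalFlag : ∀ i < k, ((B i).finalFlag = true ↔ i + 1 = k)

theorem isODD_iff {D : List (Layer A)} : IsODD D ↔ IsODDSeq (seq D) D.length := by
  simp only [IsODD, ← seq_eq_getElem, ← List.length_pos_iff]
  exact ⟨fun ⟨h₀, h₁, h₂, h₃⟩ => ⟨h₀, fun i hi => h₁ i hi, h₂, h₃⟩,
    fun ⟨h₀, h₁, h₂, h₃⟩ => ⟨h₀, fun i hi => h₁ i hi, h₂, h₃⟩⟩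

theorem IsODDSeq.initFlag_eq {B : ℕ → Layer A} {k : ℕ} (h : IsODDSeq B k) {i : ℕ} (hi : i < k) :
    (B i).initFlag = decide (i = 0) := by
  rw [Bool.eq_iff_iff, h.initFlag i hi, decide_eq_true_iff]

theorem IsODDSeq.finalFlag_eq {B : ℕ → Layer A} {k : ℕ} (h : IsODDSeq B k) {i : ℕ} (hi : i < k) :
    (B i).finalFlag = decide (i + 1 = k) := by
  rw [Bool.eq_iff_iff, h.finalFlag i hi, decide_eq_true_iff]

theorem IsODDSeq.congr {B B' : ℕ → Layer A} {k : ℕ} (h : IsODDSeq B k)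
    (hB : ∀ i < k, B' i = B i) : IsODDSeq B' k where
  pos := h.pos
  left_succ i hi := by rw [hB _ hi, hB i (by lia), h.left_succ i hi]
  initFlag i hi := by rw [hB i hi, h.initFlag i hi]
  finalFlag i hi := by rw [hB i hi, h.finalFlag i hi]

/-! ### The subset construction -/

open scoped Classical in
/-- The states to which some state in `S` has a transition labelled by `a`. -/
noncomputable def Layer.next (L : Layer A) (S : Finset ℕ) (a : A) : Finset ℕ :=
  (L.trans.filter fun t => t.1 ∈ S ∧ t.2.1 = a).image fun t => t.2.2

@[simp]
theorem Layer.mem_next {L : Layer A} {S : Finset ℕ} {a : A} {q : ℕ} :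
    q ∈ L.next S a ↔ ∃ p ∈ S, (p, a, q) ∈ L.trans := by
  simp only [Layer.next, Finset.mem_image, Finset.mem_filter, Prod.exists]
  grind

/-- The states reached after the first `i` letters of `u`. Words are infinite throughout; an ODD of
length `k` only looks at their first `k` letters. -/
noncomputable def reach (B : ℕ → Layer A) (u : ℕ → A) : ℕ → Finset ℕ
  | 0 => (B 0).init
  | i + 1 => (B i).next (reach B u i) (u i)

@[simp] theorem reach_zero (B : ℕ → Layer A) (u : ℕ → A) : reach B u 0 = (B 0).init := rfl

@[simp] theorem reach_succ (B : ℕ → Layer A) (u : ℕ → A) (i : ℕ) :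
    reach B u (i + 1) = (B i).next (reach B u i) (u i) := rfl

theorem dependsOn_reach (B : ℕ → Layer A) (i : ℕ) :
    DependsOn (fun u => reach B u i) (Set.Iio i) := by
  induction i with
  | zero => exact fun _ _ _ => rfl
  | succ i ih =>
    intro u u' h
    have hi : reach B u i = reach B u' i := ih fun j hj => h j (Nat.lt_succ_of_lt hj)
    simp only [reach_succ, hi, h i (Nat.lt_succ_self i)]

theorem reach_congr {B B' : ℕ → Layer A} (u : ℕ → A) {k i : ℕ} (hk : 0 < k) (hi : i ≤ k)
    (h : ∀ j < k, B j = B' j) : reach B u i = reach B' u i := by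
  induction i with
  | zero => simp only [reach_zero, h 0 hk]
  | succ i ih => rw [reach_succ, reach_succ, ih (by lia), h i (by lia)]

theorem reach_update (B : ℕ → Layer A) (u : ℕ → A) (i : ℕ) (a : A) :
    reach B (Function.update u i a) i = reach B u i :=
  dependsOn_reach B i fun _ hj => Function.update_of_ne (ne_of_lt hj) ..

theorem reach_update_succ (B : ℕ → Layer A) (u : ℕ → A) (i : ℕ) (a : A) :
    reach B (Function.update u i a) (i + 1) = (B i).next (reach B u i) a := by
  rw [reach_succ, reach_update, Function.update_self]

theorem mem_reach_iff (B : ℕ → Layer A) (u : ℕ → A) (i q : ℕ) :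
    q ∈ reach B u i ↔ ∃ p : ℕ → ℕ, p 0 ∈ (B 0).init ∧
      (∀ j < i, (p j, u j, p (j + 1)) ∈ (B j).trans) ∧ p i = q := by
  induction i generalizing q with
  | zero => exact ⟨fun h => ⟨fun _ => q, h, by simp, rfl⟩, by rintro ⟨p, h, -, rfl⟩; exact h⟩
  | succ i ih =>
    rw [reach_succ, Layer.mem_next]
    constructor
    · rintro ⟨p', hp', ht⟩
      obtain ⟨p, h₀, h₁, rfl⟩ := (ih _).1 hp'
      refine ⟨Function.update p (i + 1) q, by simpa using h₀, fun j hj => ?_, by simp⟩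
      rw [Function.update_of_ne (by lia)]
      rcases Nat.lt_succ_iff_lt_or_eq.1 hj with hj | rfl
      · rw [Function.update_of_ne (by lia)]
        exact h₁ j hj
      · rwa [Function.update_self]
    · rintro ⟨p, h₀, h₁, rfl⟩
      exact ⟨p i, (ih _).2 ⟨p, h₀, fun j hj => h₁ j (by lia), rfl⟩, h₁ i (by lia)⟩

/-- The infinite words whose first `k` letters are accepted by the first `k` layers of `B`. -/
def seqLang (B : ℕ → Layer A) (k : ℕ) : Set (ℕ → A) :=
  {u | ∃ q ∈ reach B u k, q ∈ (B (k - 1)).final}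

theorem mem_seqLang_iff_of_reach_eq {B : ℕ → Layer A} {k : ℕ} {u u' : ℕ → A}
    (h : reach B u k = reach B u' k) : u ∈ seqLang B k ↔ u' ∈ seqLang B k := by
  simp only [seqLang, Set.mem_ofPred_eq, h]

theorem dependsOn_mem_seqLang (B : ℕ → Layer A) (k : ℕ) :
    DependsOn (· ∈ seqLang B k) (Set.Iio k) :=
  fun _ _ h => propext (mem_seqLang_iff_of_reach_eq (dependsOn_reach B k h))

theorem seqLang_congr {B B' : ℕ → Layer A} {k : ℕ} (hk : 0 < k) (h : ∀ j < k, B j = B' j) :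
    seqLang B k = seqLang B' k := by
  ext u
  simp only [seqLang, Set.mem_ofPred_eq, reach_congr u hk le_rfl h, h (k - 1) (by lia)]

theorem accepts_iff [Inhabited A] {D : List (Layer A)} (hD : D ≠ []) (s : List A) :
    Accepts D s ↔ s.length = D.length ∧ (fun i => s.getD i default) ∈ seqLang (seq D) D.length := by
  have hpos := List.length_pos_iff.2 hD
  have hhead : D.head hD = seq D 0 := by
    rw [seq_eq_getElem D hpos, List.head_eq_getElem]
  have hlast : D.getLast hD = seq D (D.length - 1) := by
    rw [seq_eq_getElem D (by lia), List.getLast_eq_getElem]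
  have htrans (hs : s.length = D.length) (p : ℕ → ℕ) (i : ℕ) (hi : i < D.length) :
      (p i, s[i], p (i + 1)) ∈ D[i].trans ↔
        (p i, s.getD i default, p (i + 1)) ∈ (seq D i).trans := by
    have hget : s.getD i default = s[i] := (List.getElem_eq_getD default).symm
    rw [seq_eq_getElem D hi, hget]
  simp only [Accepts, seqLang, Set.mem_ofPred_eq, mem_reach_iff, hhead, hlast]
  constructor
  · rintro ⟨hs, _, p, h₀, h₁, h₂⟩
    exact ⟨hs, p D.length, ⟨p, h₀, fun i hi => (htrans hs p i hi).1 (h₁ i hi), rfl⟩, h₂⟩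
  · rintro ⟨hs, _, ⟨p, h₀, h₁, rfl⟩, h₂⟩
    exact ⟨hs, hD, p, h₀, fun i hi => (htrans hs p i hi).2 (h₁ i hi), h₂⟩

theorem lang_eq_iff [Nonempty A] {D D' : List (Layer A)} (hD : D ≠ []) (hD' : D' ≠ []) :
    lang D = lang D' ↔ D.length = D'.length ∧
      seqLang (seq D) D.length = seqLang (seq D') D'.length := by
  inhabit A
  simp only [lang, Prod.mk.injEq, Set.ext_iff, Set.mem_ofPred_eq, accepts_iff hD, accepts_iff hD']
  refine and_congr_right fun hl => ?_
  rw [← hl]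
  refine ⟨fun h u => ?_, fun h s => by rw [h]⟩
  let s := List.ofFn fun i : Fin D.length => u i
  have hs : s.length = D.length := List.length_ofFn
  have hu : ∀ i ∈ Set.Iio D.length, u i = s.getD i default := fun i (hi : i < _) => by simp [s, hi]
  rw [mem_seqLang_iff_of_reach_eq (dependsOn_reach _ _ hu),
    mem_seqLang_iff_of_reach_eq (dependsOn_reach (seq D') _ hu)]
  simpa only [hs, true_and] using h s

/-! ### Runs of deterministic, complete ODDs -/

/-- The states of an ODD after `i` letters. -/
def level (B : ℕ → Layer A) : ℕ → Finset ℕ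
  | 0 => (B 0).left
  | i + 1 => (B i).right

@[simp] theorem level_succ (B : ℕ → Layer A) (i : ℕ) : level B (i + 1) = (B i).right := rfl

theorem IsODDSeq.left_eq {B : ℕ → Layer A} {k : ℕ} (h : IsODDSeq B k) {i : ℕ} (hi : i < k) :
    (B i).left = level B i := by
  cases i with
  | zero => rfl
  | succ i => exact h.left_succ i hi

theorem IsODDSeq.right_eq {B : ℕ → Layer A} {k : ℕ} (h : IsODDSeq B k) :
    (B (k - 1)).right = level B k := by
  rw [← level_succ, Nat.sub_add_cancel h.pos]

theorem IsODDSeq.finalFlag_last {B : ℕ → Layer A} {k : ℕ} (h : IsODDSeq B k) :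
    (B (k - 1)).finalFlag = true :=
  (h.finalFlag _ (Nat.sub_lt h.pos one_pos)).2 (Nat.sub_add_cancel h.pos)

theorem reach_subset_level (B : ℕ → Layer A) (u : ℕ → A) (i : ℕ) : reach B u i ⊆ level B i := by
  cases i with
  | zero => exact (B 0).init_subset
  | succ i =>
    intro q hq
    obtain ⟨p, -, h⟩ := Layer.mem_next.1 hq
    exact ((B i).trans_mem _ _ _ h).2

theorem numStates_eq {D : List (Layer A)} (hD : D ≠ []) :
    numStates D = ∑ i ∈ Finset.range (D.length + 1), (level (seq D) i).card := by
  have hleft : (D.head?.elim 0 fun L => L.left.card) = (level (seq D) 0).card := by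
    obtain ⟨L, D, rfl⟩ := List.exists_cons_of_ne_nil hD
    rfl
  have hright : (D.map fun L => L.right.card).sum =
      ∑ i ∈ Finset.range D.length, (level (seq D) (i + 1)).card := by
    conv_lhs => rw [← map_seq_range D, List.map_map]
    rfl
  rw [numStates, hleft, hright, Finset.sum_range_succ', add_comm]

/-- The first `k` members of `B` form a deterministic, complete ODD. -/
structure IsCDSeq (B : ℕ → Layer A) (k : ℕ) : Prop extends IsODDSeq B k where
  det : ∀ i < k, (B i).IsDeterministic
  complete : ∀ i < k, (B i).IsComplete

theorem isCDSeq_seq_iff {D : List (Layer A)} :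
    IsCDSeq (seq D) D.length ↔
      IsODD D ∧ (∀ L ∈ D, L.IsDeterministic) ∧ ∀ L ∈ D, L.IsComplete := by
  rw [isODD_iff, forall_mem_iff_seq, forall_mem_iff_seq]
  exact ⟨fun h => ⟨h.toIsODDSeq, h.det, h.complete⟩, fun ⟨h, hd, hc⟩ => ⟨h, hd, hc⟩⟩

/-- The state of a deterministic, complete ODD after `i` letters of `u`, read off as the largest
element of the singleton `reach B u i`. -/
noncomputable def run (B : ℕ → Layer A) (u : ℕ → A) (i : ℕ) : ℕ := (reach B u i).sup id

theorem run_update (B : ℕ → Layer A) (u : ℕ → A) (i : ℕ) (a : A) :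
    run B (Function.update u i a) i = run B u i := by
  rw [run, reach_update, run]

namespace IsCDSeq

variable {B : ℕ → Layer A} {k : ℕ}

theorem init_eq_level_zero (h : IsCDSeq B k) : (B 0).init = level B 0 :=
  ((h.det 0 h.pos).1 ((h.initFlag 0 h.pos).2 rfl)).1

theorem card_level_zero (h : IsCDSeq B k) : (level B 0).card = 1 :=
  ((h.det 0 h.pos).1 ((h.initFlag 0 h.pos).2 rfl)).2

theorem exists_next_eq_singleton (h : IsCDSeq B k) {i : ℕ} (hi : i < k) {p : ℕ}
    (hp : p ∈ (B i).left) (a : A) : ∃ q, (B i).next {p} a = {q} := by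
  obtain ⟨q, hq, ht⟩ := (h.complete i hi).2 p hp a
  refine ⟨q, Finset.ext fun q' => ?_⟩
  simp only [Layer.mem_next, Finset.mem_singleton, exists_eq_left]
  refine ⟨fun ht' => ?_, by rintro rfl; exact ht⟩
  exact (h.det i hi).2 p hp a q' ((B i).trans_mem _ _ _ ht').2 q hq ht' ht

theorem reach_eq (h : IsCDSeq B k) (u : ℕ → A) {i : ℕ} (hi : i ≤ k) :
    reach B u i = {run B u i} := by
  suffices H : ∃ q, reach B u i = {q} by
    obtain ⟨q, hq⟩ := H
    rw [run, hq, Finset.sup_singleton, id]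
  induction i with
  | zero => exact Finset.card_eq_one.1 (by rw [reach_zero, h.init_eq_level_zero, h.card_level_zero])
  | succ i ih =>
    obtain ⟨p, hp⟩ := ih (Nat.le_of_succ_le hi)
    have hp' : p ∈ (B i).left :=
      h.left_eq hi ▸ reach_subset_level B u i (hp ▸ Finset.mem_singleton_self p)
    rw [reach_succ, hp]
    exact h.exists_next_eq_singleton hi hp' (u i)

theorem run_mem (h : IsCDSeq B k) (u : ℕ → A) {i : ℕ} (hi : i ≤ k) : run B u i ∈ level B i :=
  reach_subset_level B u i (h.reach_eq u hi ▸ Finset.mem_singleton_self _)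

theorem mem_trans_iff (h : IsCDSeq B k) (u : ℕ → A) {i : ℕ} (hi : i < k) {a : A} {q : ℕ} :
    (run B u i, a, q) ∈ (B i).trans ↔ q = run B (Function.update u i a) (i + 1) := by
  rw [← Finset.mem_singleton, ← h.reach_eq _ hi, reach_update_succ, h.reach_eq u hi.le]
  simp only [Layer.mem_next, Finset.mem_singleton, exists_eq_left]

theorem run_mem_final_iff (h : IsCDSeq B k) (u : ℕ → A) :
    run B u k ∈ (B (k - 1)).final ↔ u ∈ seqLang B k := by
  simp only [seqLang, Set.mem_ofPred_eq, h.reach_eq u le_rfl, Finset.mem_singleton,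
    exists_eq_left]

end IsCDSeq

/-- The first `k` members of `B` form a deterministic, complete ODD all of whose layers are
reachable, so that every state is the state after some word. -/
structure IsAccessibleSeq (B : ℕ → Layer A) (k : ℕ) : Prop extends IsCDSeq B k where
  reachable : ∀ i < k, (B i).IsReachable

namespace IsAccessibleSeq

variable {B : ℕ → Layer A} {k : ℕ}

theorem range_run [Nonempty A] (h : IsAccessibleSeq B k) {i : ℕ} (hi : i ≤ k) :
    (Set.range fun u => run B u i) = level B i := by
  refine (Set.range_subset_iff.2 fun u => h.run_mem u hi).antisymm fun q hq => ?_
  induction i generalizing q with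
  | zero =>
    inhabit A
    have hlevel : level B 0 = {run B (fun _ => default) 0} :=
      h.init_eq_level_zero.symm.trans (h.reach_eq _ hi)
    rw [hlevel, Finset.coe_singleton] at hq
    exact ⟨_, hq.symm⟩
  | succ i ih =>
    obtain ⟨a, p, hp, ht⟩ := h.reachable i hi q hq
    rw [h.left_eq hi] at hp
    obtain ⟨u, rfl⟩ := ih (Nat.le_of_succ_le hi) p hp
    exact ⟨_, ((h.mem_trans_iff u hi).1 ht).symm⟩

theorem mem_level_iff [Nonempty A] (h : IsAccessibleSeq B k) {i : ℕ} (hi : i ≤ k) {q : ℕ} :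
    q ∈ level B i ↔ ∃ u, run B u i = q := by
  rw [← Finset.mem_coe, ← h.range_run hi, Set.mem_range]

theorem mem_trans_iff_exists_run [Nonempty A] (h : IsAccessibleSeq B k) {i : ℕ} (hi : i < k)
    {p q : ℕ} {a : A} :
    (p, a, q) ∈ (B i).trans ↔ ∃ u, run B u i = p ∧ u i = a ∧ run B u (i + 1) = q := by
  constructor
  · intro ht
    obtain ⟨u, rfl⟩ := (h.mem_level_iff hi.le).1 (h.left_eq hi ▸ ((B i).trans_mem _ _ _ ht).1)
    exact ⟨Function.update u i a, run_update B u i a, Function.update_self ..,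
      ((h.mem_trans_iff u hi).1 ht).symm⟩
  · rintro ⟨u, rfl, rfl, rfl⟩
    rw [h.mem_trans_iff u hi, Function.update_eq_self]

theorem mem_final_iff_exists_run [Nonempty A] (h : IsAccessibleSeq B k) {q : ℕ} :
    q ∈ (B (k - 1)).final ↔ ∃ u ∈ seqLang B k, run B u k = q := by
  constructor
  · intro hq
    obtain ⟨u, rfl⟩ := (h.mem_level_iff le_rfl).1 (h.right_eq ▸ (B (k - 1)).final_subset hq)
    exact ⟨u, (h.run_mem_final_iff u).1 hq, rfl⟩
  · rintro ⟨u, hu, rfl⟩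
    exact (h.run_mem_final_iff u).2 hu

end IsAccessibleSeq

/-! ### Reduced ODDs -/

/-- Distinct left states have distinct outgoing transitions, and, in a last layer, right states
are distinguished by being final. -/
def Layer.IsReduced (L : Layer A) : Prop :=
  (∀ p ∈ L.left, ∀ p' ∈ L.left, (∀ a q, (p, a, q) ∈ L.trans ↔ (p', a, q) ∈ L.trans) → p = p') ∧
  (L.finalFlag = true → ∀ q ∈ L.right, ∀ q' ∈ L.right, (q ∈ L.final ↔ q' ∈ L.final) → q = q')

/-- Words that lead to the same states of an ODD lead to the same state of an equivalent reduced
one: by backward induction, two states of a reduced ODD that accept the same suffixes are equal. -/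
theorem factorsThrough_run_reach {B C : ℕ → Layer A} {k : ℕ} (hC : IsCDSeq C k)
    (hr : ∀ i < k, (C i).IsReduced) (hL : seqLang C k = seqLang B k) {i : ℕ} (hi : i ≤ k) :
    (fun u => run C u i).FactorsThrough fun u => reach B u i := by
  induction hi using Nat.decreasingInduction with
  | self =>
    intro u u' (h : reach B u k = reach B u' k)
    have hmem (v : ℕ → A) : run C v k ∈ (C (k - 1)).right := hC.right_eq ▸ hC.run_mem v le_rfl
    refine (hr _ (Nat.sub_lt hC.pos one_pos)).2 hC.finalFlag_last _ (hmem u) _ (hmem u') ?_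
    rw [hC.run_mem_final_iff, hC.run_mem_final_iff, hL, mem_seqLang_iff_of_reach_eq h]
  | of_succ i hi ih =>
    intro u u' (h : reach B u i = reach B u' i)
    have hmem (v : ℕ → A) : run C v i ∈ (C i).left := hC.left_eq hi ▸ hC.run_mem v hi.le
    refine (hr i hi).1 _ (hmem u) _ (hmem u') fun a q => ?_
    have hnext : reach B (Function.update u i a) (i + 1) =
        reach B (Function.update u' i a) (i + 1) := by
      rw [reach_update_succ, reach_update_succ, h]
    have hrun : run C (Function.update u i a) (i + 1) = run C (Function.update u' i a) (i + 1) :=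
      ih hnext
    rw [hC.mem_trans_iff u hi, hC.mem_trans_iff u' hi, hrun]

section FactorsThrough

variable {X Y Z : Type*} {f : X → Y} {g : X → Z} {s : Finset Y} {t : Finset Z}

theorem card_le_of_factorsThrough (h : g.FactorsThrough f) (hf : ∀ x, f x ∈ s)
    (hg : Set.range g = t) : t.card ≤ s.card := by
  classical
  rcases isEmpty_or_nonempty X with hX | ⟨⟨x₀⟩⟩
  · rw [Set.range_eq_empty, eq_comm, Finset.coe_eq_empty] at hg
    simp only [hg, Finset.card_empty, Nat.zero_le]
  have : Nonempty Z := ⟨g x₀⟩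
  obtain ⟨e, rfl⟩ := (Function.factorsThrough_iff g).1 h
  refine Finset.card_le_card_of_surjOn e ?_
  rw [← hg]
  exact Set.range_subset_iff.2 fun x => Set.mem_image_of_mem e (hf x)

theorem factorsThrough_of_card_le (h : g.FactorsThrough f) (hf : Set.range f = s)
    (hg : Set.range g = t) (hcard : s.card ≤ t.card) : f.FactorsThrough g := by
  intro x x' hx
  have : Nonempty Z := ⟨g x⟩
  obtain ⟨e, rfl⟩ := (Function.factorsThrough_iff g).1 h
  have hmem (x : X) : f x ∈ (s : Set Y) := hf ▸ Set.mem_range_self x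
  have hmaps : Set.MapsTo e s t := by
    rw [← hf, ← hg]
    rintro _ ⟨x, rfl⟩
    exact ⟨x, rfl⟩
  have hsurj : Set.SurjOn e s t := by
    rw [← hf, ← hg]
    rintro _ ⟨x, rfl⟩
    exact ⟨f x, ⟨x, rfl⟩, rfl⟩
  exact Finset.injOn_of_surjOn_of_card_le e hmaps hsurj hcard (hmem x) (hmem x') hx

end FactorsThrough

theorem card_level_le_of_reach_mem [Nonempty A] {B C : ℕ → Layer A} {k : ℕ}
    (hC : IsAccessibleSeq C k) (hr : ∀ i < k, (C i).IsReduced) (hL : seqLang C k = seqLang B k)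
    {i : ℕ} (hi : i ≤ k) {P : Finset (Finset ℕ)} (hP : ∀ u, reach B u i ∈ P) :
    (level C i).card ≤ P.card :=
  card_le_of_factorsThrough (factorsThrough_run_reach hC.toIsCDSeq hr hL hi) hP (hC.range_run hi)

theorem card_level_le [Nonempty A] {B C : ℕ → Layer A} {k : ℕ} (hC : IsAccessibleSeq C k)
    (hr : ∀ i < k, (C i).IsReduced) (hL : seqLang C k = seqLang B k) (hB : IsCDSeq B k)
    {i : ℕ} (hi : i ≤ k) : (level C i).card ≤ (level B i).card := by
  refine (card_level_le_of_reach_mem hC hr hL hi (P := (level B i).image fun q => {q})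
    fun u => ?_).trans Finset.card_image_le
  rw [hB.reach_eq u hi]
  exact Finset.mem_image_of_mem _ (hB.run_mem u hi)

/-! ### Uniqueness of reduced normalized ODDs -/

theorem run_eq_run_iff [Nonempty A] {B C : ℕ → Layer A} {k : ℕ} (hB : IsAccessibleSeq B k)
    (hC : IsAccessibleSeq C k) (hr : ∀ i < k, (C i).IsReduced) (hL : seqLang C k = seqLang B k)
    {i : ℕ} (hi : i ≤ k) (hcard : (level B i).card ≤ (level C i).card) (u u' : ℕ → A) :
    run B u i = run B u' i ↔ run C u i = run C u' i := by
  have hfac : (fun u => run C u i).FactorsThrough fun u => run B u i := fun u u' h =>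
    factorsThrough_run_reach hC.toIsCDSeq hr hL hi <| by
      simpa only [hB.reach_eq _ hi, Finset.singleton_inj] using h
  exact ⟨fun h => hfac h,
    fun h => factorsThrough_of_card_le hfac (hB.range_run hi) (hC.range_run hi) hcard h⟩

/-- The first `k` members of `B` form a deterministic, complete, normalized ODD. -/
structure IsNormalizedSeq [LinearOrder A] (B : ℕ → Layer A) (k : ℕ) : Prop
    extends IsCDSeq B k where
  normalized : ∀ i < k, (B i).IsNormalized

namespace IsNormalizedSeq

variable [LinearOrder A] {B : ℕ → Layer A} {k : ℕ}

theorem isAccessibleSeq (h : IsNormalizedSeq B k) : IsAccessibleSeq B k :=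
  ⟨h.toIsCDSeq, fun i hi => (h.normalized i hi).1.1⟩

theorem level_eq_range (h : IsNormalizedSeq B k) {i : ℕ} (hi : i ≤ k) :
    level B i = Finset.range (level B i).card := by
  obtain ⟨w, hw⟩ : ∃ w, level B i = Finset.range w := by
    cases i with
    | zero =>
      obtain ⟨w, -, -, -, hw, -⟩ := (h.normalized 0 h.pos).2
      exact ⟨w, hw⟩
    | succ i =>
      obtain ⟨-, w, -, -, -, hw⟩ := (h.normalized i hi).2
      exact ⟨w, hw⟩
  rw [hw, Finset.card_range]

theorem isLowerSet_range_run [Nonempty A] (h : IsNormalizedSeq B k) {i : ℕ} (hi : i ≤ k) :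
    IsLowerSet (Set.range fun u => run B u i) := by
  rw [h.isAccessibleSeq.range_run hi, h.level_eq_range hi, Finset.coe_range]
  exact isLowerSet_Iio _

end IsNormalizedSeq

theorem le_of_lt_imp_lt_of_isLowerSet {X N : Type*} [LinearOrder N] [WellFoundedLT N]
    {f g : X → N} (hf : IsLowerSet (Set.range f)) (h : ∀ x y, f x < f y → g x < g y) (x : X) :
    f x ≤ g x := by
  induction hn : f x using WellFoundedLT.induction generalizing x with
  | ind n ih =>
    subst hn
    by_contra! hlt
    obtain ⟨y, hy⟩ := hf hlt.le ⟨x, rfl⟩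
    exact (ih (g x) hlt y hy).not_gt (h y x (hy ▸ hlt))

theorem Layer.exists_isLeast_incoming [LinearOrder A] {L : Layer A} (hL : L.IsReachable) {q : ℕ}
    (hq : q ∈ L.right) : ∃ x, IsLeast (L.incoming q) x := by
  have hfin : (L.incoming q).Finite :=
    (L.trans.finite_toSet.image fun t => toLex (t.1, t.2.1)).subset fun x hx => ⟨_, hx, rfl⟩
  obtain ⟨a, p, -, ht⟩ := hL q hq
  have hne : hfin.toFinset.Nonempty := ⟨toLex (p, a), hfin.mem_toFinset.2 ht⟩
  exact ⟨_, by simpa only [hfin.coe_toFinset] using hfin.toFinset.isLeast_min' hne⟩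

theorem Layer.IsWellOrdered.lt_iff_lt [LinearOrder A] {L M : Layer A} (hL : L.IsWellOrdered)
    (hM : M.IsWellOrdered) {q q' r r' : ℕ} (hq : q ∈ L.right) (hq' : q' ∈ L.right)
    (hr : r ∈ M.right) (hr' : r' ∈ M.right) (h : L.incoming q = M.incoming r)
    (h' : L.incoming q' = M.incoming r') : q < q' ↔ r < r' := by
  obtain ⟨x, hx⟩ := exists_isLeast_incoming hL.1 hq
  obtain ⟨x', hx'⟩ := exists_isLeast_incoming hL.1 hq'
  rw [hL.2.2 q hq q' hq' x x' hx hx', hM.2.2 r hr r' hr' x x' (h ▸ hx) (h' ▸ hx')]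

theorem incoming_run_eq [Nonempty A] {B C : ℕ → Layer A} {k i : ℕ}
    (hB : IsAccessibleSeq B k) (hC : IsAccessibleSeq C k) (hi : i < k)
    (hrun : ∀ u, run B u i = run C u i)
    (hker : ∀ u u', run B u (i + 1) = run B u' (i + 1) ↔ run C u (i + 1) = run C u' (i + 1))
    (u : ℕ → A) : (B i).incoming (run B u (i + 1)) = (C i).incoming (run C u (i + 1)) := by
  ext x
  simp only [Layer.incoming, Set.mem_ofPred_eq, hB.mem_trans_iff_exists_run hi,
    hC.mem_trans_iff_exists_run hi, hrun, hker]

/-- A normalized ODD numbers its states by the order of their least incoming pairs, so its runs are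
determined by which words lead to the same state. -/
theorem run_eq_run [LinearOrder A] [Nonempty A] {B C : ℕ → Layer A} {k : ℕ}
    (hB : IsNormalizedSeq B k) (hC : IsNormalizedSeq C k)
    (hker : ∀ i ≤ k, ∀ u u', run B u i = run B u' i ↔ run C u i = run C u' i) {i : ℕ}
    (hi : i ≤ k) (u : ℕ → A) : run B u i = run C u i := by
  induction i generalizing u with
  | zero =>
    have run_zero {E : ℕ → Layer A} (hE : IsNormalizedSeq E k) : run E u 0 = 0 := by
      have hmem := hE.run_mem u hi
      rwa [hE.level_eq_range hi, hE.card_level_zero, Finset.range_one, Finset.mem_singleton] at hmem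
    rw [run_zero hB, run_zero hC]
  | succ i ih =>
    have hinc (u : ℕ → A) :=
      incoming_run_eq hB.isAccessibleSeq hC.isAccessibleSeq hi (ih (Nat.le_of_succ_le hi))
        (hker (i + 1) hi) u
    have hlt (u u' : ℕ → A) :
        run B u (i + 1) < run B u' (i + 1) ↔ run C u (i + 1) < run C u' (i + 1) :=
      (hB.normalized i hi).1.lt_iff_lt (hC.normalized i hi).1 (hB.run_mem u hi)
        (hB.run_mem u' hi) (hC.run_mem u hi) (hC.run_mem u' hi) (hinc u) (hinc u')
    exact le_antisymm
      (le_of_lt_imp_lt_of_isLowerSet (hB.isLowerSet_range_run hi) (fun u u' => (hlt u u').1) u)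
      (le_of_lt_imp_lt_of_isLowerSet (hC.isLowerSet_range_run hi) (fun u u' => (hlt u u').2) u)

theorem seq_eq_of_run_eq [Nonempty A] {B C : ℕ → Layer A} {k : ℕ} (hB : IsAccessibleSeq B k)
    (hC : IsAccessibleSeq C k) (hL : seqLang C k = seqLang B k)
    (hrun : ∀ i ≤ k, ∀ u, run B u i = run C u i) {i : ℕ} (hi : i < k) : B i = C i := by
  have hlevel (j : ℕ) (hj : j ≤ k) : level B j = level C j := by
    rw [← Finset.coe_inj, ← hB.range_run hj, ← hC.range_run hj]
    simp only [hrun j hj]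
  have hleft : (B i).left = (C i).left := by
    rw [hB.left_eq hi, hC.left_eq hi, hlevel i hi.le]
  have htrans : (B i).trans = (C i).trans := by
    ext ⟨p, a, q⟩
    simp only [hB.mem_trans_iff_exists_run hi, hC.mem_trans_iff_exists_run hi, hrun i hi.le,
      hrun (i + 1) hi]
  have hinitFlag : (B i).initFlag = (C i).initFlag := by
    rw [hB.initFlag_eq hi, hC.initFlag_eq hi]
  have hfinalFlag : (B i).finalFlag = (C i).finalFlag := by
    rw [hB.finalFlag_eq hi, hC.finalFlag_eq hi]
  have hinit : (B i).init = (C i).init := by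
    cases hb : (B i).initFlag with
    | false => rw [(B i).init_eq_empty hb, (C i).init_eq_empty (hinitFlag ▸ hb)]
    | true => rw [((hB.det i hi).1 hb).1, ((hC.det i hi).1 (hinitFlag ▸ hb)).1, hleft]
  have hfinal : (B i).final = (C i).final := by
    cases hb : (B i).finalFlag with
    | false => rw [(B i).final_eq_empty hb, (C i).final_eq_empty (hfinalFlag ▸ hb)]
    | true =>
      obtain rfl : i = k - 1 := Nat.eq_sub_of_add_eq ((hB.finalFlag i hi).1 hb)
      ext q
      simp only [hB.mem_final_iff_exists_run, hC.mem_final_iff_exists_run, hL, hrun k le_rfl]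
  exact Layer.ext hleft (hlevel (i + 1) hi) htrans hinit hfinal hinitFlag hfinalFlag

theorem seq_eq_of_card_level_le [Nonempty A] [LinearOrder A] {B C : ℕ → Layer A} {k : ℕ}
    (hB : IsNormalizedSeq B k) (hC : IsNormalizedSeq C k) (hr : ∀ i < k, (C i).IsReduced)
    (hL : seqLang C k = seqLang B k) (hcard : ∀ i ≤ k, (level B i).card ≤ (level C i).card)
    {i : ℕ} (hi : i < k) : B i = C i :=
  seq_eq_of_run_eq hB.isAccessibleSeq hC.isAccessibleSeq hL
    (fun _ hj u => run_eq_run hB hC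
      (fun i hi => run_eq_run_iff hB.isAccessibleSeq hC.isAccessibleSeq hr hL hi (hcard i hi))
      hj u) hi

/-! ### Existence of reduced normalized ODDs -/

section Rank

variable {S O : Type*} [LinearOrder O]

/-- The number of members of `X` with a smaller value of `ξ` than `x`: the position of `x` when `X`
is listed in increasing order of `ξ`. -/
def rank (X : Finset S) (ξ : S → O) (x : S) : ℕ := (X.filter fun y => ξ y < ξ x).card

theorem rank_lt_rank_iff {X : Finset S} {ξ : S → O} {x y : S} (hx : x ∈ X) :
    rank X ξ x < rank X ξ y ↔ ξ x < ξ y := by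
  constructor <;> intro h
  · by_contra! hle
    exact h.not_ge (Finset.card_le_card <|
      Finset.monotone_filter_right X fun _ _ hz => lt_of_lt_of_le hz hle)
  · refine Finset.card_lt_card <| Finset.ssubset_iff_of_subset
      (Finset.monotone_filter_right X fun _ _ hz => lt_trans hz h) |>.2 ⟨x, ?_, ?_⟩
    · exact Finset.mem_filter.2 ⟨hx, h⟩
    · exact fun hx => lt_irrefl _ (Finset.mem_filter.1 hx).2

theorem rank_injOn {X : Finset S} {ξ : S → O} (hξ : Set.InjOn ξ X) : Set.InjOn (rank X ξ) X := by
  intro x hx y hy h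
  refine hξ hx hy (le_antisymm ?_ ?_)
  · exact not_lt.1 fun hlt => h.not_gt ((rank_lt_rank_iff hy).2 hlt)
  · exact not_lt.1 fun hlt => h.not_lt ((rank_lt_rank_iff hx).2 hlt)

theorem image_rank {X : Finset S} {ξ : S → O} (hξ : Set.InjOn ξ X) :
    X.image (rank X ξ) = Finset.range X.card := by
  refine Finset.eq_of_subset_of_card_le (Finset.image_subset_iff.2 fun x hx => ?_) ?_
  · refine Finset.mem_range.2 <| Finset.card_lt_card <|
      (Finset.filter_ssubset (p := fun y => ξ y < ξ x)).2 ⟨x, hx, lt_irrefl _⟩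
  · rw [Finset.card_range, Finset.card_image_of_injOn (rank_injOn hξ)]

end Rank

/-- A deterministic automaton with state set `S` whose transition function depends on the position
in the word: the source of the states of a normalized ODD before they are numbered. -/
structure LevelledDFA (A : Type u) (S : Type v) where
  start : S
  step : ℕ → S → A → S
  accept : Set S

namespace LevelledDFA

variable {S : Type v} (T : LevelledDFA A S)

/-- The state after the first `i` letters of `u`. -/
def eval (u : ℕ → A) : ℕ → S
  | 0 => T.start
  | i + 1 => T.step i (eval u i) (u i)

@[simp] theorem eval_zero (u : ℕ → A) : T.eval u 0 = T.start := rfl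

@[simp] theorem eval_succ (u : ℕ → A) (i : ℕ) :
    T.eval u (i + 1) = T.step i (T.eval u i) (u i) := rfl

theorem dependsOn_eval (i : ℕ) : DependsOn (fun u => T.eval u i) (Set.Iio i) := by
  induction i with
  | zero => exact fun _ _ _ => rfl
  | succ i ih =>
    intro u u' h
    have hi : T.eval u i = T.eval u' i := ih fun j hj => h j (Nat.lt_succ_of_lt hj)
    simp only [eval_succ, hi, h i (Nat.lt_succ_self i)]

theorem eval_update (u : ℕ → A) (i : ℕ) (a : A) :
    T.eval (Function.update u i a) i = T.eval u i :=
  T.dependsOn_eval i fun _ hj => Function.update_of_ne (ne_of_lt hj) ..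

variable [Fintype A]

open scoped Classical in
/-- The states that are reached by the words of length `i`. -/
noncomputable def states : ℕ → Finset S
  | 0 => {T.start}
  | i + 1 => (states i ×ˢ (Finset.univ : Finset A)).image fun t => T.step i t.1 t.2

theorem states_zero : T.states 0 = {T.start} := rfl

theorem mem_states_succ {i : ℕ} {x : S} :
    x ∈ T.states (i + 1) ↔ ∃ y ∈ T.states i, ∃ a, T.step i y a = x := by
  simp [states]

theorem step_mem_states {i : ℕ} {x : S} (hx : x ∈ T.states i) (a : A) :
    T.step i x a ∈ T.states (i + 1) :=
  T.mem_states_succ.2 ⟨x, hx, a, rfl⟩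

theorem mem_states_iff [Nonempty A] {i : ℕ} {x : S} :
    x ∈ T.states i ↔ ∃ u, T.eval u i = x := by
  induction i generalizing x with
  | zero => simp only [states_zero, Finset.mem_singleton, eval_zero, exists_const, eq_comm]
  | succ i ih =>
    rw [mem_states_succ]
    constructor
    · rintro ⟨y, hy, a, rfl⟩
      obtain ⟨u, rfl⟩ := ih.1 hy
      exact ⟨Function.update u i a, by rw [eval_succ, eval_update, Function.update_self]⟩
    · rintro ⟨u, rfl⟩
      exact ⟨T.eval u i, ih.2 ⟨u, rfl⟩, u i, rfl⟩

theorem eval_mem_states (u : ℕ → A) (i : ℕ) : T.eval u i ∈ T.states i :=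
  have : Nonempty A := ⟨u 0⟩
  T.mem_states_iff.2 ⟨u, rfl⟩

theorem card_states_pos [Nonempty A] (i : ℕ) : 1 ≤ (T.states i).card := by
  inhabit A
  exact Finset.card_pos.2 ⟨_, T.eval_mem_states (fun _ => default) i⟩

open scoped Classical in
/-- The pairs of the number of a state at level `i` and a letter that lead to `x`. -/
noncomputable def preds (num : S → ℕ) (i : ℕ) (x : S) : Finset (ℕ ×ₗ A) :=
  ((T.states i ×ˢ (Finset.univ : Finset A)).filter fun t => T.step i t.1 t.2 = x).image
    fun t => toLex (num t.1, t.2)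

theorem mem_preds {num : S → ℕ} {i : ℕ} {x : S} {p : ℕ} {a : A} :
    toLex (p, a) ∈ T.preds num i x ↔ ∃ y ∈ T.states i, num y = p ∧ T.step i y a = x := by
  simp only [preds, Finset.mem_image, Finset.mem_filter, Finset.mem_product, Finset.mem_univ,
    and_true, Prod.exists, EmbeddingLike.apply_eq_iff_eq, Prod.mk.injEq]
  grind

theorem preds_nonempty {num : S → ℕ} {i : ℕ} {x : S} (hx : x ∈ T.states (i + 1)) :
    (T.preds num i x).Nonempty := by
  obtain ⟨y, hy, a, h⟩ := T.mem_states_succ.1 hx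
  exact ⟨toLex (num y, a), T.mem_preds.2 ⟨y, hy, rfl, h⟩⟩

variable [LinearOrder A]

/-- The numbering of the states at each level in the order of their least predecessors. -/
noncomputable def number : ℕ → S → ℕ
  | 0 => fun _ => 0
  | i + 1 => rank (T.states (i + 1)) fun x => (T.preds (number i) i x).min

theorem min_preds_injOn {num : S → ℕ} {i : ℕ} (h : Set.InjOn num (T.states i)) :
    Set.InjOn (fun x => (T.preds num i x).min) (T.states (i + 1)) := by
  intro x hx x' _ hxx'
  obtain ⟨m, hm⟩ := Finset.min_of_nonempty (T.preds_nonempty hx)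
  obtain ⟨⟨p, a⟩, rfl⟩ := toLex.surjective m
  obtain ⟨y, hy, rfl, rfl⟩ := T.mem_preds.1 (Finset.mem_of_min hm)
  obtain ⟨y', hy', hyy', rfl⟩ := T.mem_preds.1 (Finset.mem_of_min (hxx'.symm.trans hm))
  rw [h hy' hy hyy']

theorem number_injOn (i : ℕ) : Set.InjOn (T.number i) (T.states i) := by
  induction i with
  | zero => rw [states_zero, Finset.coe_singleton]; exact Set.injOn_singleton _ _
  | succ i ih => exact rank_injOn (T.min_preds_injOn ih)

theorem number_inj {i : ℕ} {x y : S} (hx : x ∈ T.states i) (hy : y ∈ T.states i) :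
    T.number i x = T.number i y ↔ x = y :=
  (T.number_injOn i).eq_iff hx hy

theorem image_number (i : ℕ) :
    (T.states i).image (T.number i) = Finset.range (T.states i).card := by
  cases i with
  | zero => rfl
  | succ i => exact image_rank (T.min_preds_injOn (T.number_injOn i))

theorem number_mem {i : ℕ} {x : S} (hx : x ∈ T.states i) :
    T.number i x ∈ Finset.range (T.states i).card :=
  T.image_number i ▸ Finset.mem_image_of_mem _ hx

theorem exists_number_eq {i q : ℕ} (hq : q ∈ Finset.range (T.states i).card) :
    ∃ x ∈ T.states i, T.number i x = q :=
  Finset.mem_image.1 (T.image_number i ▸ hq)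

open scoped Classical in
/-- The layers of the ODD of length `k` whose states are the numbered states of `T`. -/
noncomputable def toSeq (k i : ℕ) : Layer A where
  left := Finset.range (T.states i).card
  right := Finset.range (T.states (i + 1)).card
  trans := (T.states i ×ˢ (Finset.univ : Finset A)).image fun t =>
    (T.number i t.1, t.2, T.number (i + 1) (T.step i t.1 t.2))
  init := if i = 0 then Finset.range (T.states i).card else ∅
  final := if i + 1 = k then
    ((T.states (i + 1)).filter fun x => x ∈ T.accept).image (T.number (i + 1)) else ∅
  initFlag := decide (i = 0)
  finalFlag := decide (i + 1 = k)
  trans_mem p a q h := by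
    simp only [Finset.mem_image, Finset.mem_product, Finset.mem_univ, and_true, Prod.mk.injEq,
      Prod.exists] at h
    obtain ⟨y, b, hy, rfl, rfl, rfl⟩ := h
    exact ⟨T.number_mem hy, T.number_mem (T.step_mem_states hy b)⟩
  init_subset := by split_ifs <;> simp
  final_subset := by
    split_ifs
    · exact Finset.image_subset_iff.2 fun x hx => T.number_mem (Finset.mem_filter.1 hx).1
    · exact Finset.empty_subset _
  init_eq_empty h := if_neg (of_decide_eq_false h)
  final_eq_empty h := if_neg (of_decide_eq_false h)

theorem mem_trans_toSeq {k i p q : ℕ} {a : A} :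
    (p, a, q) ∈ (T.toSeq k i).trans ↔
      ∃ y ∈ T.states i, T.number i y = p ∧ T.number (i + 1) (T.step i y a) = q := by
  simp only [toSeq, Finset.mem_image, Finset.mem_product, Finset.mem_univ, and_true,
    Prod.mk.injEq, Prod.exists]
  grind

theorem number_mem_trans_iff {k i q : ℕ} {a : A} {y : S} (hy : y ∈ T.states i) :
    (T.number i y, a, q) ∈ (T.toSeq k i).trans ↔ q = T.number (i + 1) (T.step i y a) := by
  rw [mem_trans_toSeq]
  refine ⟨?_, fun h => ⟨y, hy, rfl, h.symm⟩⟩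
  rintro ⟨y', hy', h, rfl⟩
  rw [(T.number_inj hy' hy).1 h]

theorem number_mem_final_iff {i : ℕ} {x : S} (hx : x ∈ T.states (i + 1)) :
    T.number (i + 1) x ∈ (T.toSeq (i + 1) i).final ↔ x ∈ T.accept := by
  simp only [toSeq, if_true, Finset.mem_image, Finset.mem_filter]
  refine ⟨?_, fun h => ⟨x, ⟨hx, h⟩, rfl⟩⟩
  rintro ⟨x', ⟨hx', h⟩, hn⟩
  rwa [← (T.number_inj hx' hx).1 hn]

theorem isODDSeq_toSeq {k : ℕ} (hk : 0 < k) : IsODDSeq (T.toSeq k) k where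
  pos := hk
  left_succ _ _ := rfl
  initFlag _ _ := decide_eq_true_iff
  finalFlag _ _ := decide_eq_true_iff

theorem isDeterministic_toSeq (k i : ℕ) : (T.toSeq k i).IsDeterministic := by
  constructor
  · intro h
    obtain rfl : i = 0 := of_decide_eq_true h
    simp [toSeq, states_zero]
  · intro p hp a q _ q' _ h h'
    obtain ⟨y, hy, rfl⟩ := T.exists_number_eq hp
    rw [T.number_mem_trans_iff hy] at h h'
    rw [h, h']

theorem isComplete_toSeq (k i : ℕ) : (T.toSeq k i).IsComplete := by
  constructor
  · intro h
    obtain rfl : i = 0 := of_decide_eq_true h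
    simp [toSeq, states_zero]
  · intro p hp a
    obtain ⟨y, hy, rfl⟩ := T.exists_number_eq hp
    exact ⟨_, T.number_mem (T.step_mem_states hy a), (T.number_mem_trans_iff hy).2 rfl⟩

theorem isReachable_toSeq (k i : ℕ) : (T.toSeq k i).IsReachable := by
  intro q hq
  obtain ⟨x, hx, rfl⟩ := T.exists_number_eq hq
  obtain ⟨y, hy, a, rfl⟩ := T.mem_states_succ.1 hx
  exact ⟨a, _, T.number_mem hy, (T.number_mem_trans_iff hy).2 rfl⟩

theorem incoming_toSeq {k i : ℕ} {x : S} (hx : x ∈ T.states (i + 1)) :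
    (T.toSeq k i).incoming (T.number (i + 1) x) = T.preds (T.number i) i x := by
  ext ⟨p, a⟩
  refine T.mem_trans_toSeq.trans (Iff.trans ?_ T.mem_preds.symm)
  exact exists_congr fun y => and_congr_right fun hy => and_congr_right fun _ =>
    T.number_inj (T.step_mem_states hy a) hx

theorem min_preds_eq_of_isLeast {k i : ℕ} {x : S} (hx : x ∈ T.states (i + 1)) {m : ℕ ×ₗ A}
    (hm : IsLeast ((T.toSeq k i).incoming (T.number (i + 1) x)) m) :
    (T.preds (T.number i) i x).min = m := by
  rw [T.incoming_toSeq hx] at hm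
  rw [← Finset.coe_min' (T.preds_nonempty hx), (Finset.isLeast_min' _ _).unique hm]

theorem isWellOrdered_toSeq (k i : ℕ) : (T.toSeq k i).IsWellOrdered := by
  refine ⟨T.isReachable_toSeq k i, T.isDeterministic_toSeq k i, fun q hq q' hq' m m' hm hm' => ?_⟩
  obtain ⟨x, hx, rfl⟩ := T.exists_number_eq hq
  obtain ⟨x', hx', rfl⟩ := T.exists_number_eq hq'
  refine (rank_lt_rank_iff hx).trans ?_
  rw [T.min_preds_eq_of_isLeast hx hm, T.min_preds_eq_of_isLeast hx' hm', WithTop.coe_lt_coe]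

theorem isNormalizedSeq_toSeq [Nonempty A] {k : ℕ} (hk : 0 < k) :
    IsNormalizedSeq (T.toSeq k) k where
  toIsODDSeq := T.isODDSeq_toSeq hk
  det i _ := T.isDeterministic_toSeq k i
  complete i _ := T.isComplete_toSeq k i
  normalized i _ := ⟨T.isWellOrdered_toSeq k i, _, _, T.card_states_pos i,
    T.card_states_pos (i + 1), rfl, rfl⟩

theorem isReduced_toSeq {k : ℕ} (hstep : ∀ i, Function.Injective (T.step i))
    (haccept : Set.InjOn (· ∈ T.accept) (T.states k)) (i : ℕ) : (T.toSeq k i).IsReduced := by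
  constructor
  · intro p hp p' hp' h
    obtain ⟨y, hy, rfl⟩ := T.exists_number_eq hp
    obtain ⟨y', hy', rfl⟩ := T.exists_number_eq hp'
    suffices hyy' : T.step i y = T.step i y' by rw [hstep i hyy']
    funext a
    have ht := (h a _).1 ((T.number_mem_trans_iff hy).2 rfl)
    rwa [T.number_mem_trans_iff hy',
      T.number_inj (T.step_mem_states hy a) (T.step_mem_states hy' a)] at ht
  · intro hf q hq q' hq' h
    obtain rfl : i + 1 = k := of_decide_eq_true hf
    obtain ⟨y, hy, rfl⟩ := T.exists_number_eq hq
    obtain ⟨y', hy', rfl⟩ := T.exists_number_eq hq'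
    rw [T.number_mem_final_iff hy, T.number_mem_final_iff hy'] at h
    rw [haccept hy hy' (propext h)]

theorem reach_toSeq (k : ℕ) (u : ℕ → A) (i : ℕ) :
    reach (T.toSeq k) u i = {T.number i (T.eval u i)} := by
  induction i with
  | zero => simp [toSeq, states_zero, number]
  | succ i ih =>
    ext q
    simp only [reach_succ, ih, Layer.mem_next, Finset.mem_singleton, exists_eq_left,
      T.number_mem_trans_iff (T.eval_mem_states u i), eval_succ]

theorem mem_seqLang_toSeq {k : ℕ} (hk : 0 < k) {u : ℕ → A} :
    u ∈ seqLang (T.toSeq k) k ↔ T.eval u k ∈ T.accept := by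
  obtain ⟨i, rfl⟩ := Nat.exists_eq_succ_of_ne_zero hk.ne'
  simp only [seqLang, Set.mem_ofPred_eq, reach_toSeq, Finset.mem_singleton, exists_eq_left]
  exact T.number_mem_final_iff (T.eval_mem_states u (i + 1))

end LevelledDFA

/-- The automaton of the residuals of `K`: after the letters `u 0, …, u (i - 1)` its state is the
set of all words that belong to `K` once their first `i` letters are replaced by these. -/
def residualDFA (K : Set (ℕ → A)) : LevelledDFA A (Set (ℕ → A)) where
  start := K
  step i r a := {g | Function.update g i a ∈ r}
  accept := {r | r.Nonempty}

theorem step_residualDFA_injective (K : Set (ℕ → A)) (i : ℕ) :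
    Function.Injective ((residualDFA K).step i) := by
  intro r r' h
  ext g
  have hg : Function.update g i (g i) ∈ r ↔ Function.update g i (g i) ∈ r' :=
    Set.ext_iff.1 (congrFun h (g i)) g
  rwa [Function.update_eq_self] at hg

theorem mem_eval_residualDFA (K : Set (ℕ → A)) (u g : ℕ → A) (i : ℕ) :
    g ∈ (residualDFA K).eval u i ↔ (fun j => if j < i then u j else g j) ∈ K := by
  induction i generalizing g with
  | zero => simp only [LevelledDFA.eval_zero, Nat.not_lt_zero, if_false]; rfl
  | succ i ih =>
    refine (ih _).trans (iff_of_eq (congrArg (· ∈ K) (funext fun j => ?_)))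
    rcases eq_or_ne j i with rfl | hj
    · simp
    · simp only [Function.update_of_ne hj, Nat.lt_succ_iff_lt_or_eq, hj, or_false]

theorem eval_residualDFA {K : Set (ℕ → A)} {k : ℕ} (hK : DependsOn (· ∈ K) (Set.Iio k))
    (u : ℕ → A) : (residualDFA K).eval u k = {_g | u ∈ K} := by
  ext g
  rw [mem_eval_residualDFA]
  exact iff_of_eq (hK fun j hj => if_pos hj)

theorem eval_residualDFA_mem_accept {K : Set (ℕ → A)} {k : ℕ}
    (hK : DependsOn (· ∈ K) (Set.Iio k)) (u : ℕ → A) :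
    (residualDFA K).eval u k ∈ (residualDFA K).accept ↔ u ∈ K := by
  rw [eval_residualDFA hK]
  exact ⟨fun ⟨_, h⟩ => h, fun h => ⟨u, h⟩⟩

/-- The first `k` members of `C` form a reduced normalized ODD that is equivalent to the first `k`
members of `B`. -/
structure IsReducedForm [LinearOrder A] (B C : ℕ → Layer A) (k : ℕ) : Prop where
  normalized : IsNormalizedSeq C k
  reduced : ∀ i < k, (C i).IsReduced
  seqLang_eq : seqLang C k = seqLang B k

theorem IsReducedForm.congr [LinearOrder A] {B C C' : ℕ → Layer A} {k : ℕ}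
    (h : IsReducedForm B C k) (hC : ∀ i < k, C' i = C i) : IsReducedForm B C' k where
  normalized :=
    { toIsODDSeq := h.normalized.congr hC
      det := fun i hi => hC i hi ▸ h.normalized.det i hi
      complete := fun i hi => hC i hi ▸ h.normalized.complete i hi
      normalized := fun i hi => hC i hi ▸ h.normalized.normalized i hi }
  reduced i hi := hC i hi ▸ h.reduced i hi
  seqLang_eq := (seqLang_congr h.normalized.pos hC).trans h.seqLang_eq

theorem exists_isReducedForm [Finite A] [Nonempty A] [LinearOrder A] (B : ℕ → Layer A) {k : ℕ}
    (hk : 0 < k) : ∃ C, IsReducedForm B C k := by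
  cases nonempty_fintype A
  have hB := dependsOn_mem_seqLang B k
  set T := residualDFA (seqLang B k)
  refine ⟨T.toSeq k, T.isNormalizedSeq_toSeq hk, fun i _ =>
    T.isReduced_toSeq (step_residualDFA_injective _) ?_ i, Set.ext fun u => ?_⟩
  · intro r hr r' hr' h
    obtain ⟨u, rfl⟩ := T.mem_states_iff.1 hr
    obtain ⟨u', rfl⟩ := T.mem_states_iff.1 hr'
    have hiff : u ∈ seqLang B k ↔ u' ∈ seqLang B k := by
      rw [← eval_residualDFA_mem_accept hB u, ← eval_residualDFA_mem_accept hB u']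
      exact iff_of_eq h
    rw [eval_residualDFA hB, eval_residualDFA hB]
    simp only [hiff]
  · rw [T.mem_seqLang_toSeq hk, eval_residualDFA_mem_accept hB]

/-! ### Canonical forms -/

theorem exists_mem_cdOdds {D : List (Layer A)} (hD : IsCDSeq (seq D) D.length) :
    ∃ w, 1 ≤ w ∧ D ∈ cdOdds A w := by
  classical
  obtain ⟨hodd, hdet, hcomp⟩ := isCDSeq_seq_iff.1 hD
  obtain ⟨w, hw⟩ := (D.toFinset.biUnion fun L => L.left ∪ L.right).exists_nat_subset_range
  refine ⟨w + 1, w.succ_pos, hodd, fun L hL =>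
    ⟨Finset.union_subset_iff.1 ?_, hdet L hL, hcomp L hL⟩⟩
  calc L.left ∪ L.right
      ⊆ D.toFinset.biUnion fun L => L.left ∪ L.right :=
        Finset.subset_biUnion_of_mem (fun L => L.left ∪ L.right) (List.mem_toFinset.2 hL)
    _ ⊆ Finset.range w := hw
    _ ⊆ Finset.range (w + 1) := Finset.range_subset_range.2 w.le_succ

section IsReduced

variable [Nonempty A]

theorem card_level_le_of_lang_eq {C D : List (Layer A)} (hC : IsAccessibleSeq (seq C) C.length)
    (hr : ∀ L ∈ C, L.IsReduced) (hD : IsCDSeq (seq D) D.length) (hlang : lang C = lang D)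
    {i : ℕ} (hi : i ≤ C.length) : (level (seq C) i).card ≤ (level (seq D) i).card := by
  obtain ⟨hl, hL⟩ :=
    (lang_eq_iff (isODD_iff.2 hC.toIsODDSeq).1 (isODD_iff.2 hD.toIsODDSeq).1).1 hlang
  rw [← hl] at hD hL
  exact card_level_le hC (forall_mem_iff_seq.1 hr) hL hD hi

theorem isMinimized_of_isReduced {C : List (Layer A)} (hC : IsAccessibleSeq (seq C) C.length)
    (hr : ∀ L ∈ C, L.IsReduced) : IsMinimized C := by
  intro w _ D hD hlang
  have hcd : IsCDSeq (seq D) D.length :=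
    isCDSeq_seq_iff.2 ⟨hD.1, fun L hL => (hD.2 L hL).2.1, fun L hL => (hD.2 L hL).2.2⟩
  have hl : D.length = C.length := congrArg Prod.fst hlang
  rw [numStates_eq (isODD_iff.2 hC.toIsODDSeq).1, numStates_eq hD.1.1, hl]
  exact Finset.sum_le_sum fun i hi =>
    card_level_le_of_lang_eq hC hr hcd hlang.symm (Finset.mem_range_succ_iff.1 hi)

theorem IsMinimized.card_level_eq {C D : List (Layer A)} (hmin : IsMinimized D)
    (hD : IsCDSeq (seq D) D.length) (hC : IsAccessibleSeq (seq C) C.length)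
    (hr : ∀ L ∈ C, L.IsReduced) (hlang : lang C = lang D) {i : ℕ} (hi : i ≤ C.length) :
    (level (seq C) i).card = (level (seq D) i).card := by
  obtain ⟨w, hw, hCw⟩ := exists_mem_cdOdds hC.toIsCDSeq
  have hl : D.length = C.length := congrArg Prod.fst hlang.symm
  have hsum := hmin w hw C hCw hlang
  rw [numStates_eq hCw.1.1, numStates_eq (isODD_iff.2 hD.toIsODDSeq).1, hl] at hsum
  have hle : ∀ j ∈ Finset.range (C.length + 1), (level (seq C) j).card ≤ (level (seq D) j).card :=
    fun j hj => card_level_le_of_lang_eq hC hr hD hlang (Finset.mem_range_succ_iff.1 hj)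
  exact (Finset.sum_eq_sum_iff_of_le hle).1 ((Finset.sum_le_sum hle).antisymm hsum) i
    (Finset.mem_range_succ_iff.2 hi)

theorem IsMinimized.eq_of_isReduced [LinearOrder A] {C D : List (Layer A)} (hmin : IsMinimized D)
    (hD : IsNormalizedSeq (seq D) D.length) (hC : IsNormalizedSeq (seq C) C.length)
    (hr : ∀ L ∈ C, L.IsReduced) (hlang : lang C = lang D) : D = C := by
  obtain ⟨hl, hL⟩ :=
    (lang_eq_iff (isODD_iff.2 hC.toIsODDSeq).1 (isODD_iff.2 hD.toIsODDSeq).1).1 hlang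
  have hcard {i : ℕ} (hi : i ≤ C.length) :=
    hmin.card_level_eq hD.toIsCDSeq hC.isAccessibleSeq hr hlang hi
  rw [← hl] at hD hL
  exact ext_seq hl.symm fun i hi => seq_eq_of_card_level_le hD hC (forall_mem_iff_seq.1 hr) hL
    (fun _ hj => (hcard hj).ge) (hi.trans_eq hl.symm)

end IsReduced

section IsCanonicalForm

variable [LinearOrder A] {C D : List (Layer A)}

theorem isCanonicalForm_iff_isMinimized :
    IsCanonicalForm D C ↔
      IsNormalizedSeq (seq C) C.length ∧ IsMinimized C ∧ lang C = lang D := by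
  have hnorm : IsNormalizedSeq (seq C) C.length ↔
      IsCDSeq (seq C) C.length ∧ ∀ L ∈ C, L.IsNormalized := by
    rw [forall_mem_iff_seq]
    exact ⟨fun h => ⟨h.toIsCDSeq, h.normalized⟩, fun h => ⟨h.1, h.2⟩⟩
  rw [hnorm, isCDSeq_seq_iff, IsCanonicalForm]
  tauto

variable [Nonempty A]

theorem isReducedForm_seq_iff (hD : D ≠ []) :
    C.length = D.length ∧ IsReducedForm (seq D) (seq C) D.length ↔
      IsNormalizedSeq (seq C) C.length ∧ (∀ L ∈ C, L.IsReduced) ∧ lang C = lang D := by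
  rw [forall_mem_iff_seq]
  constructor
  · rintro ⟨hl, h⟩
    rw [← hl] at h
    refine ⟨h.normalized, h.reduced, ?_⟩
    rw [lang_eq_iff (isODD_iff.2 h.normalized.toIsODDSeq).1 hD, ← hl]
    exact ⟨rfl, h.seqLang_eq⟩
  · rintro ⟨hn, hr, hlang⟩
    obtain ⟨hl, hL⟩ := (lang_eq_iff (isODD_iff.2 hn.toIsODDSeq).1 hD).1 hlang
    rw [← hl] at hL ⊢
    exact ⟨rfl, hn, hr, hL⟩

variable [Finite A]

theorem exists_isReduced_lang_eq (hD : IsODD D) : ∃ C : List (Layer A),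
    IsNormalizedSeq (seq C) C.length ∧ (∀ L ∈ C, L.IsReduced) ∧ lang C = lang D := by
  obtain ⟨C, hC⟩ := exists_isReducedForm (seq D) (isODD_iff.1 hD).pos
  exact ⟨(List.range D.length).map C, (isReducedForm_seq_iff hD.1).1
    ⟨by simp, hC.congr fun i hi => seq_map_range C hi⟩⟩

/-- Minimality, which refers to all other ODDs, amounts to a condition on single layers. -/
theorem isCanonicalForm_iff (hD : IsODD D) :
    IsCanonicalForm D C ↔ C.length = D.length ∧ IsReducedForm (seq D) (seq C) D.length := by
  rw [isCanonicalForm_iff_isMinimized, isReducedForm_seq_iff hD.1]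
  constructor
  · rintro ⟨hn, hmin, hlang⟩
    obtain ⟨E, hE, hr, hlangE⟩ := exists_isReduced_lang_eq hD
    rw [hmin.eq_of_isReduced hn hE hr (hlangE.trans hlang.symm)]
    exact ⟨hE, hr, hlangE⟩
  · rintro ⟨hn, hr, hlang⟩
    exact ⟨hn, isMinimized_of_isReduced hn.isAccessibleSeq hr, hlang⟩

theorem exists_isCanonicalForm (hD : IsODD D) : ∃ C, IsCanonicalForm D C := by
  obtain ⟨C, hn, hr, hlang⟩ := exists_isReduced_lang_eq hD
  exact ⟨C, isCanonicalForm_iff_isMinimized.2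
    ⟨hn, isMinimized_of_isReduced hn.isAccessibleSeq hr, hlang⟩⟩

theorem IsCanonicalForm.unique {C' : List (Layer A)} (hD : IsODD D) (h : IsCanonicalForm D C)
    (h' : IsCanonicalForm D C') : C = C' := by
  obtain ⟨hn, hmin, hlang⟩ := isCanonicalForm_iff_isMinimized.1 h
  obtain ⟨hn', hr, hlang'⟩ := (isReducedForm_seq_iff hD.1).1 ((isCanonicalForm_iff hD).1 h')
  exact hmin.eq_of_isReduced hn hn' hr (hlang'.trans hlang.symm)

end IsCanonicalForm

/-! ### The automaton of the canonization -/

section Runs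

variable {σ : Type*} (M : NFA A σ)

theorem mem_evalFrom_iff_exists_run {S : Set σ} {x : List A} {q : σ} :
    q ∈ M.evalFrom S x ↔ ∃ f : ℕ → σ, f 0 ∈ S ∧
      (∀ (i : ℕ) (h : i < x.length), f (i + 1) ∈ M.step (f i) x[i]) ∧ f x.length = q := by
  induction x generalizing S with
  | nil => exact ⟨fun h => ⟨fun _ => q, h, by simp, rfl⟩, by rintro ⟨f, h, -, rfl⟩; exact h⟩
  | cons a x ih =>
    rw [NFA.evalFrom_cons, ih]
    constructor
    · rintro ⟨f, h₀, h₁, rfl⟩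
      obtain ⟨p, hp, hpf⟩ := M.mem_stepSet.1 h₀
      refine ⟨fun i => Nat.casesOn i p f, hp, fun i hi => ?_, rfl⟩
      cases i with
      | zero => exact hpf
      | succ i => exact h₁ i (Nat.lt_of_succ_lt_succ hi)
    · rintro ⟨f, h₀, h₁, rfl⟩
      exact ⟨fun i => f (i + 1), M.mem_stepSet.2 ⟨f 0, h₀, h₁ 0 (Nat.succ_pos _)⟩,
        fun i hi => h₁ (i + 1) (Nat.succ_lt_succ hi), rfl⟩

theorem mem_accepts_iff_exists_run {x : List A} :
    x ∈ M.accepts ↔ ∃ f : ℕ → σ, f 0 ∈ M.start ∧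
      (∀ (i : ℕ) (h : i < x.length), f (i + 1) ∈ M.step (f i) x[i]) ∧ f x.length ∈ M.accept := by
  rw [NFA.mem_accepts]
  simp only [mem_evalFrom_iff_exists_run]
  constructor
  · rintro ⟨_, hq, f, h₀, h₁, rfl⟩
    exact ⟨f, h₀, h₁, hq⟩
  · rintro ⟨f, h₀, h₁, hq⟩
    exact ⟨_, hq, f, h₀, h₁, rfl⟩

end Runs

/-- What the automaton remembers after it has read some layers of `D` and `C`: the current states
of `D`, the number of current states of `C`, a relation `sim` between the sets of states of `D` and
the states of `C` that are reached by the same words, and whether the first and the last layers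
have been read. -/
structure Config where
  states : Finset ℕ
  width : ℕ
  sim : Finset ℕ → ℕ → Prop
  started : Bool
  finished : Bool

/-- The automaton may pass from `s` to `t` when it reads the layer `L ∈ K` of `D` and the layer `M`
of `C`, whose width is at most `m`. -/
structure Config.Step [LinearOrder A] (K : Set (Layer A)) (m : ℕ) (s t : Config) (L M : Layer A) :
    Prop where
  mem_left : L ∈ K
  mem_right : M ∈ cdLayers A m
  normalized : M.IsNormalized
  reduced : M.IsReduced
  not_finished : s.finished = false
  started : t.started = true
  left_eq : s.started = true → L.left = s.states ∧ M.left = Finset.range s.width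
  right_eq : L.right = t.states ∧ M.right = Finset.range t.width
  initFlag : L.initFlag = !s.started ∧ M.initFlag = !s.started
  finalFlag : L.finalFlag = t.finished ∧ M.finalFlag = t.finished
  start : s.started = false → ∀ q ∈ M.init, s.sim L.init q
  sim : ∀ S q a q', s.sim S q → (q, a, q') ∈ M.trans → t.sim (L.next S a) q'
  final : t.finished = true → ∀ S q, t.sim S q → ((∃ p ∈ S, p ∈ L.final) ↔ q ∈ M.final)

/-- An accepting run on the first `k` layers of `B` and `C`. -/
structure IsAcceptingRun [LinearOrder A] (K : Set (Layer A)) (m k : ℕ) (B C : ℕ → Layer A)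
    (f : ℕ → Config) : Prop where
  not_started : (f 0).started = false
  not_finished : (f 0).finished = false
  step : ∀ i < k, Config.Step K m (f i) (f (i + 1)) (B i) (C i)
  finished : (f k).finished = true

section Run

variable [LinearOrder A] {K : Set (Layer A)} {m k : ℕ} {B C : ℕ → Layer A} {f : ℕ → Config}

namespace IsAcceptingRun

theorem pos (h : IsAcceptingRun K m k B C f) : 0 < k := by
  refine Nat.pos_of_ne_zero ?_
  rintro rfl
  exact Bool.false_ne_true (h.not_finished.symm.trans h.finished)

theorem not_started_iff (h : IsAcceptingRun K m k B C f) {i : ℕ} (hi : i ≤ k) :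
    (!(f i).started) = true ↔ i = 0 := by
  cases i with
  | zero => simp [h.not_started]
  | succ i => simp [(h.step i hi).started]

theorem finished_iff (h : IsAcceptingRun K m k B C f) {i : ℕ} (hi : i ≤ k) :
    (f i).finished = true ↔ i = k := by
  rcases hi.eq_or_lt with rfl | hlt
  · simp [h.finished]
  · simp [(h.step i hlt).not_finished, hlt.ne]

theorem isODDSeq_left (h : IsAcceptingRun K m k B C f) : IsODDSeq B k where
  pos := h.pos
  left_succ i hi := by
    have hstep := h.step i (Nat.lt_of_succ_lt hi)
    rw [hstep.right_eq.1, ((h.step (i + 1) hi).left_eq hstep.started).1]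
  initFlag i hi := by rw [(h.step i hi).initFlag.1, h.not_started_iff hi.le]
  finalFlag i hi := by rw [(h.step i hi).finalFlag.1, h.finished_iff hi]

theorem isNormalizedSeq_right (h : IsAcceptingRun K m k B C f) : IsNormalizedSeq C k where
  pos := h.pos
  left_succ i hi := by
    have hstep := h.step i (Nat.lt_of_succ_lt hi)
    rw [hstep.right_eq.2, ((h.step (i + 1) hi).left_eq hstep.started).2]
  initFlag i hi := by rw [(h.step i hi).initFlag.2, h.not_started_iff hi.le]
  finalFlag i hi := by rw [(h.step i hi).finalFlag.2, h.finished_iff hi]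
  det i hi := (h.step i hi).mem_right.2.1
  complete i hi := (h.step i hi).mem_right.2.2
  normalized i hi := (h.step i hi).normalized

theorem sim_reach (h : IsAcceptingRun K m k B C f) (u : ℕ → A) {i : ℕ} (hi : i ≤ k) :
    (f i).sim (reach B u i) (run C u i) := by
  have hC := h.isNormalizedSeq_right.toIsCDSeq
  induction i with
  | zero =>
    refine (h.step 0 h.pos).start h.not_started _ ?_
    rw [hC.init_eq_level_zero]
    exact hC.run_mem u hi
  | succ i ih =>
    refine (h.step i hi).sim _ _ _ _ (ih (Nat.le_of_succ_le hi)) ((hC.mem_trans_iff u hi).2 ?_)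
    rw [Function.update_eq_self]

theorem seqLang_eq (h : IsAcceptingRun K m k B C f) : seqLang C k = seqLang B k := by
  ext u
  rw [← h.isNormalizedSeq_right.run_mem_final_iff]
  have hk : k - 1 + 1 = k := Nat.sub_add_cancel h.pos
  have hstep := h.step (k - 1) (Nat.sub_lt h.pos one_pos)
  rw [hk] at hstep
  exact (hstep.final h.finished _ _ (h.sim_reach u le_rfl)).symm

theorem isReducedForm (h : IsAcceptingRun K m k B C f) : IsReducedForm B C k where
  normalized := h.isNormalizedSeq_right
  reduced i hi := (h.step i hi).reduced
  seqLang_eq := h.seqLang_eq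

end IsAcceptingRun

/-- The configuration after `i` layers of the canonical run. -/
noncomputable def canonicalConfig (k : ℕ) (B C : ℕ → Layer A) (i : ℕ) : Config where
  states := level B i
  width := (level C i).card
  sim S q := ∃ u, reach B u i = S ∧ run C u i = q
  started := !decide (i = 0)
  finished := decide (i = k)

theorem step_canonicalConfig [Nonempty A] (hB : IsODDSeq B k) (hK : ∀ i < k, B i ∈ K)
    (h : IsReducedForm B C k) (hm : ∀ i < k, C i ∈ cdLayers A m) {i : ℕ} (hi : i < k) :
    Config.Step K m (canonicalConfig k B C i) (canonicalConfig k B C (i + 1)) (B i) (C i) where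
  mem_left := hK i hi
  mem_right := hm i hi
  normalized := h.normalized.normalized i hi
  reduced := h.reduced i hi
  not_finished := decide_eq_false hi.ne
  started := rfl
  left_eq _ := ⟨hB.left_eq hi, (h.normalized.left_eq hi).trans (h.normalized.level_eq_range hi.le)⟩
  right_eq := ⟨rfl, h.normalized.level_eq_range (i := i + 1) hi⟩
  initFlag := by
    rw [hB.initFlag_eq hi, h.normalized.initFlag_eq hi]
    exact ⟨(Bool.not_not _).symm, (Bool.not_not _).symm⟩
  finalFlag := ⟨hB.finalFlag_eq hi, h.normalized.finalFlag_eq hi⟩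
  start hs q hq := by
    obtain rfl : i = 0 := by simpa [canonicalConfig] using hs
    obtain ⟨u, rfl⟩ := (h.normalized.isAccessibleSeq.mem_level_iff hi.le).1 ((C 0).init_subset hq)
    exact ⟨u, rfl, rfl⟩
  sim := by
    rintro _ _ a q ⟨u, rfl, rfl⟩ ht
    exact ⟨Function.update u i a, reach_update_succ B u i a,
      ((h.normalized.mem_trans_iff u hi).1 ht).symm⟩
  final hf := by
    obtain rfl : i + 1 = k := of_decide_eq_true hf
    rintro _ _ ⟨u, rfl, rfl⟩
    exact (iff_of_eq (congrArg (u ∈ ·) h.seqLang_eq)).symm.trans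
      (h.normalized.run_mem_final_iff u).symm

theorem isAcceptingRun_canonicalConfig [Nonempty A] (hB : IsODDSeq B k) (hK : ∀ i < k, B i ∈ K)
    (h : IsReducedForm B C k) (hm : ∀ i < k, C i ∈ cdLayers A m) :
    IsAcceptingRun K m k B C (canonicalConfig k B C) where
  not_started := rfl
  not_finished := decide_eq_false hB.pos.ne
  step _ hi := step_canonicalConfig hB hK h hm hi
  finished := decide_eq_true rfl

end Run

/-- The codes of the configurations whose states lie in `{0, …, w - 1}` and whose relation is a
partial function from `P` to `{0, …, |P| - 1}`. -/
abbrev Code (w : ℕ) (P : Finset (Finset ℕ)) : Type :=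
  (Finset.range w).powerset × Fin (P.card + 1) × (P → Option (Fin P.card)) × Bool × Bool

theorem card_code (w : ℕ) (P : Finset (Finset ℕ)) :
    Fintype.card (Code w P) = 4 * 2 ^ w * (P.card + 1) ^ (P.card + 1) := by
  simp only [Code, Fintype.card_prod, Fintype.card_coe, Finset.card_powerset, Finset.card_range,
    Fintype.card_fin, Fintype.card_fun, Fintype.card_option, Fintype.card_bool]
  ring

/-- The configuration with a given code. -/
def Code.config {w : ℕ} {P : Finset (Finset ℕ)} : Code w P → Config
  | (S, n, g, b, e) =>
    { states := S
      width := n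
      sim := fun S q => ∃ (hS : S ∈ P) (x : Fin P.card), g ⟨S, hS⟩ = some x ∧ (x : ℕ) = q
      started := b
      finished := e }

theorem exists_partialFun_iff {P : Finset (Finset ℕ)} {n : ℕ} {R : Finset ℕ → ℕ → Prop}
    (hR : ∀ S q, R S q → S ∈ P ∧ q < n) (huniq : ∀ S q q', R S q → R S q' → q = q') :
    ∃ g : P → Option (Fin n), ∀ S q,
      (∃ (hS : S ∈ P) (x : Fin n), g ⟨S, hS⟩ = some x ∧ (x : ℕ) = q) ↔ R S q := by
  classical
  refine ⟨fun S => if h : ∃ q, R S q then some ⟨h.choose, (hR _ _ h.choose_spec).2⟩ else none,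
    fun S q => ⟨?_, fun h => ?_⟩⟩
  · rintro ⟨hS, x, hx, rfl⟩
    beta_reduce at hx
    split_ifs at hx with h
    rw [← Option.some.inj hx]
    exact h.choose_spec
  · have hex : ∃ q, R S q := ⟨q, h⟩
    exact ⟨(hR _ _ h).1, _, dif_pos hex, huniq _ _ _ hex.choose_spec h⟩

theorem exists_code {w : ℕ} {P : Finset (Finset ℕ)} {s : Config}
    (hstates : s.states ⊆ Finset.range w) (hwidth : s.width ≤ P.card)
    (hsim : ∀ S q, s.sim S q → S ∈ P ∧ q < P.card)
    (huniq : ∀ S q q', s.sim S q → s.sim S q' → q = q') : ∃ c : Code w P, c.config = s := by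
  obtain ⟨g, hg⟩ := exists_partialFun_iff hsim huniq
  refine ⟨(⟨s.states, Finset.mem_powerset.2 hstates⟩, ⟨s.width, Nat.lt_succ_of_le hwidth⟩, g,
    s.started, s.finished), ?_⟩
  simp only [Code.config, hg]

/-- The automaton that accepts the pairs of an ODD with layers in `K` and its canonical form. -/
def canonizer [LinearOrder A] (K : Set (Layer A)) (w : ℕ) (P : Finset (Finset ℕ)) :
    NFA (Layer A × Layer A) (Code w P) where
  step c x := {c' | Config.Step K P.card c.config c'.config x.1 x.2}
  start := {c | c.config.started = false ∧ c.config.finished = false}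
  accept := {c | c.config.finished = true}

theorem mem_accepts_canonizer_iff [LinearOrder A] {K : Set (Layer A)} {w : ℕ}
    {P : Finset (Finset ℕ)} {z : List (Layer A × Layer A)} :
    z ∈ (canonizer K w P).accepts ↔ ∃ f : ℕ → Code w P,
      IsAcceptingRun K P.card z.length (seq (z.map Prod.fst)) (seq (z.map Prod.snd))
        fun i => (f i).config := by
  have hstep (f : ℕ → Code w P) (i : ℕ) (hi : i < z.length) :
      f (i + 1) ∈ (canonizer K w P).step (f i) z[i] ↔ Config.Step K P.card (f i).config
        (f (i + 1)).config (seq (z.map Prod.fst) i) (seq (z.map Prod.snd) i) := by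
    rw [seq_eq_getElem _ (by simpa using hi), seq_eq_getElem _ (by simpa using hi),
      List.getElem_map, List.getElem_map]
    rfl
  rw [mem_accepts_iff_exists_run]
  refine exists_congr fun f => ⟨fun ⟨h₀, h₁, h₂⟩ => ?_, fun h => ?_⟩
  · exact ⟨h₀.1, h₀.2, fun i hi => (hstep f i hi).1 (h₁ i hi), h₂⟩
  · exact ⟨⟨h.not_started, h.not_finished⟩, fun i hi => (hstep f i hi).2 (h.step i hi), h.finished⟩

/-- The ODDs with layers in `K` have width at most `w`, and `P` contains all sets of states that
words reach in them. -/
structure ReachesWithin (K : Set (Layer A)) (w : ℕ) (P : Finset (Finset ℕ)) : Prop where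
  subset_layers : K ⊆ layers A w
  reach_mem : ∀ {B : ℕ → Layer A} {k : ℕ}, IsODDSeq B k → (∀ i < k, B i ∈ K) →
    ∀ (u : ℕ → A) {i : ℕ}, i ≤ k → reach B u i ∈ P

theorem level_subset_range {w k : ℕ} {B : ℕ → Layer A} (hk : 0 < k)
    (hB : ∀ i < k, B i ∈ layers A w) {i : ℕ} (hi : i ≤ k) : level B i ⊆ Finset.range w := by
  cases i with
  | zero => exact (hB 0 hk).1
  | succ i => exact (hB i hi).2

theorem reachesWithin_layers (w : ℕ) :
    ReachesWithin (layers A w) w (Finset.range w).powerset where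
  subset_layers := subset_rfl
  reach_mem h hB u _ hi := Finset.mem_powerset.2 <|
    (reach_subset_level _ u _).trans (level_subset_range h.pos hB hi)

theorem reachesWithin_cdLayers (w : ℕ) :
    ReachesWithin (cdLayers A w) w ((Finset.range w).image fun q => {q}) where
  subset_layers _ h := h.1
  reach_mem {B k} h hB u i hi := by
    have hcd : IsCDSeq B k := ⟨h, fun i hi => (hB i hi).2.1, fun i hi => (hB i hi).2.2⟩
    rw [hcd.reach_eq u hi]
    exact Finset.mem_image_of_mem _
      (level_subset_range h.pos (fun i hi => (hB i hi).1) hi (hcd.run_mem u hi))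

/-- The pairs `(D, C)` with `D` an ODD with layers in `K` and `C` its canonical form: the common
form of `canonization` and `cdCanonization`. -/
def canonizationOn [LinearOrder A] (K : Set (Layer A)) : Set (List (Layer A) × List (Layer A)) :=
  {x | (IsODD x.1 ∧ ∀ L ∈ x.1, L ∈ K) ∧ IsCanonicalForm x.1 x.2}

theorem mem_canonizationOn_iff [Finite A] [Nonempty A] [LinearOrder A] {K : Set (Layer A)}
    {D C : List (Layer A)} : (D, C) ∈ canonizationOn K ↔ C.length = D.length ∧
      IsODDSeq (seq D) D.length ∧ (∀ i < D.length, seq D i ∈ K) ∧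
      IsReducedForm (seq D) (seq C) D.length := by
  rw [canonizationOn, Set.mem_ofPred_eq, ← forall_mem_iff_seq (P := (· ∈ K)), ← isODD_iff]
  constructor
  · rintro ⟨⟨hD, hK⟩, hC⟩
    obtain ⟨hl, h⟩ := (isCanonicalForm_iff hD).1 hC
    exact ⟨hl, hD, hK, h⟩
  · rintro ⟨hl, hD, hK, h⟩
    exact ⟨⟨hD, hK⟩, (isCanonicalForm_iff hD).2 ⟨hl, h⟩⟩

theorem isFunctional_canonizationOn [Finite A] [Nonempty A] [LinearOrder A]
    (K : Set (Layer A)) : IsFunctional (canonizationOn K) :=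
  fun _ _ _ h h' => h.2.unique h.1.1 h'.2

theorem dom_canonizationOn [Finite A] [Nonempty A] [LinearOrder A] (K : Set (Layer A)) :
    dom (canonizationOn K) = {D | IsODD D ∧ ∀ L ∈ D, L ∈ K} := by
  refine Set.ext fun D => ⟨fun ⟨_, h⟩ => h.1, fun h => ?_⟩
  obtain ⟨C, hC⟩ := exists_isCanonicalForm h.1
  exact ⟨C, h, hC⟩

theorem mem_tensorLang_iff {α β : Type*} {T : Set (List α × List β)}
    (hT : ∀ x ∈ T, x.1.length = x.2.length) {z : List (α × β)} :
    z ∈ tensorLang T ↔ (z.map Prod.fst, z.map Prod.snd) ∈ T := by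
  constructor
  · rintro ⟨⟨s, t⟩, h, rfl⟩
    have hl : s.length = t.length := hT _ h
    rwa [List.map_fst_zip hl.le, List.map_snd_zip hl.ge]
  · exact fun h => ⟨_, h, List.zip_of_prod rfl rfl⟩

namespace ReachesWithin

variable [Nonempty A] [LinearOrder A] {K : Set (Layer A)} {w k : ℕ} {P : Finset (Finset ℕ)}
  {B C : ℕ → Layer A}

theorem card_level_le (hKP : ReachesWithin K w P) (hB : IsODDSeq B k) (hK : ∀ i < k, B i ∈ K)
    (h : IsReducedForm B C k) {i : ℕ} (hi : i ≤ k) : (level C i).card ≤ P.card :=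
  card_level_le_of_reach_mem h.normalized.isAccessibleSeq h.reduced h.seqLang_eq hi
    fun u => hKP.reach_mem hB hK u hi

theorem level_subset_range (hKP : ReachesWithin K w P) (hB : IsODDSeq B k)
    (hK : ∀ i < k, B i ∈ K) (h : IsReducedForm B C k) {i : ℕ} (hi : i ≤ k) :
    level C i ⊆ Finset.range P.card := by
  rw [h.normalized.level_eq_range hi]
  exact Finset.range_subset_range.2 (hKP.card_level_le hB hK h hi)

theorem mem_cdLayers (hKP : ReachesWithin K w P) (hB : IsODDSeq B k) (hK : ∀ i < k, B i ∈ K)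
    (h : IsReducedForm B C k) {i : ℕ} (hi : i < k) : C i ∈ cdLayers A P.card := by
  refine ⟨⟨?_, ?_⟩, h.normalized.det i hi, h.normalized.complete i hi⟩
  · rw [h.normalized.left_eq hi]
    exact hKP.level_subset_range hB hK h hi.le
  · exact hKP.level_subset_range hB hK h (i := i + 1) hi

theorem exists_code_eq_canonicalConfig (hKP : ReachesWithin K w P) (hB : IsODDSeq B k)
    (hK : ∀ i < k, B i ∈ K) (h : IsReducedForm B C k) {i : ℕ} (hi : i ≤ k) :
    ∃ c : Code w P, c.config = canonicalConfig k B C i := by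
  refine exists_code ?_ (hKP.card_level_le hB hK h hi) ?_ ?_
  · exact ODD.level_subset_range hB.pos (fun i hi => hKP.subset_layers (hK i hi)) hi
  · rintro _ _ ⟨u, rfl, rfl⟩
    exact ⟨hKP.reach_mem hB hK u hi, Finset.mem_range.1 <|
      hKP.level_subset_range hB hK h hi (h.normalized.run_mem u hi)⟩
  · rintro _ _ _ ⟨u, rfl, rfl⟩ ⟨u', hu, rfl⟩
    exact factorsThrough_run_reach h.normalized.toIsCDSeq h.reduced h.seqLang_eq hi hu.symm

theorem exists_isAcceptingRun_iff (hKP : ReachesWithin K w P) :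
    (∃ f : ℕ → Code w P, IsAcceptingRun K P.card k B C fun i => (f i).config) ↔
      IsODDSeq B k ∧ (∀ i < k, B i ∈ K) ∧ IsReducedForm B C k := by
  constructor
  · rintro ⟨f, hf⟩
    exact ⟨hf.isODDSeq_left, fun i hi => (hf.step i hi).mem_left, hf.isReducedForm⟩
  · rintro ⟨hB, hK, h⟩
    have hrun := isAcceptingRun_canonicalConfig hB hK h fun i hi => hKP.mem_cdLayers hB hK h hi
    have hcode (i : ℕ) (hi : i ≤ k) := hKP.exists_code_eq_canonicalConfig hB hK h hi
    have : Nonempty (Code w P) := ⟨(hcode 0 k.zero_le).choose⟩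
    choose! f hf using hcode
    refine ⟨f, ?_, ?_, fun i hi => ?_, ?_⟩
    · exact hf 0 k.zero_le ▸ hrun.not_started
    · exact hf 0 k.zero_le ▸ hrun.not_finished
    · exact hf i hi.le ▸ hf (i + 1) hi ▸ hrun.step i hi
    · exact hf k le_rfl ▸ hrun.finished

variable [Finite A]

theorem accepts_canonizer (hKP : ReachesWithin K w P) :
    (canonizer K w P).accepts = tensorLang (canonizationOn K) := by
  have hl : ∀ x ∈ canonizationOn K, x.1.length = x.2.length := fun _ hx =>
    (mem_canonizationOn_iff.1 hx).1.symm
  ext z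
  rw [mem_tensorLang_iff hl, mem_accepts_canonizer_iff, hKP.exists_isAcceptingRun_iff,
    mem_canonizationOn_iff]
  simp only [List.length_map, true_and]

theorem isTransduction_canonizationOn (hKP : ReachesWithin K w P) :
    IsTransduction K (cdLayers A P.card) (canonizationOn K) := by
  rintro ⟨D, C⟩ hx
  obtain ⟨hl, hB, hK, h⟩ := mem_canonizationOn_iff.1 hx
  have hC : IsODD C := hx.2.1
  refine ⟨(isODD_iff.2 hB).1, hC.1, hl.symm, hx.1.2, forall_mem_iff_seq.2 fun i hi => ?_⟩
  exact hKP.mem_cdLayers hB hK h (hl ▸ hi)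

theorem isRegularTransduction_canonizationOn (hKP : ReachesWithin K w P) :
    IsRegularTransduction K (cdLayers A P.card) (4 * 2 ^ w * (P.card + 1) ^ (P.card + 1))
      (canonizationOn K) :=
  ⟨hKP.isTransduction_canonizationOn, Code w P, inferInstance, canonizer K w P, (card_code w P).le,
    fun _ _ ⟨_, h⟩ => ⟨h.mem_left, h.mem_right⟩, hKP.accepts_canonizer⟩

end ReachesWithin

theorem card_code_le {m w : ℕ} (hm : 1 ≤ m) (hw : w ≤ m) :
    4 * 2 ^ w * (m + 1) ^ (m + 1) ≤ max m 2 ^ (7 * m) := by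
  set M := max m 2
  have hM : 2 ≤ M := le_max_right m 2
  have hmM : m ≤ M := le_max_left m 2
  have hsucc : m + 1 ≤ M ^ 2 := by nlinarith
  have hpow : 2 ^ w ≤ M ^ m := (Nat.pow_le_pow_right two_pos hw).trans (Nat.pow_le_pow_left hM m)
  calc 4 * 2 ^ w * (m + 1) ^ (m + 1)
    _ ≤ M ^ 2 * M ^ m * (M ^ 2) ^ (m + 1) := by
      have hfour : 4 ≤ M ^ 2 := Nat.pow_le_pow_left hM 2
      gcongr ?_ * ?_ * ?_ ^ _
    _ = M ^ (3 * m + 4) := by ring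
    _ ≤ M ^ (7 * m) := Nat.pow_le_pow_right (two_pos.trans_le hM) (by lia)

theorem isRegularTransduction_canonization [Finite A] [Nonempty A] [LinearOrder A] (w : ℕ) :
    IsRegularTransduction (layers A w) (cdLayers A (2 ^ w))
      (4 * 2 ^ w * (2 ^ w + 1) ^ (2 ^ w + 1)) (canonization A w) := by
  have h := (reachesWithin_layers (A := A) w).isRegularTransduction_canonizationOn
  rwa [Finset.card_powerset, Finset.card_range] at h

theorem isRegularTransduction_cdCanonization [Finite A] [Nonempty A] [LinearOrder A] (w : ℕ) :
    IsRegularTransduction (cdLayers A w) (cdLayers A w)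
      (4 * 2 ^ w * (w + 1) ^ (w + 1)) (cdCanonization A w) := by
  have h := (reachesWithin_cdLayers (A := A) w).isRegularTransduction_canonizationOn
  rwa [Finset.card_image_of_injective _ Finset.singleton_injective, Finset.card_range] at h

theorem natCast_le_two_rpow {n c m e : ℕ} (hc : 0 < c) (hn : n ≤ 2 ^ (m * e)) :
    (n : ℝ) ≤ 2 ^ ((m : ℝ) * (c * e)) := by
  have hexp : m * e ≤ m * (c * e) := Nat.mul_le_mul_left m (Nat.le_mul_of_pos_left e hc)
  exact_mod_cast hn.trans (Nat.pow_le_pow_right two_pos hexp)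

theorem natCast_le_two_rpow_logb {n c m e : ℕ} {b : ℝ} (hc : 0 < c) (hb : 1 ≤ b)
    (hn : (n : ℝ) ≤ b ^ (m * e)) : (n : ℝ) ≤ 2 ^ ((m : ℝ) * (c * e * Real.logb 2 b)) := by
  have hlog : 0 ≤ Real.logb 2 b := Real.logb_nonneg one_lt_two hb
  have hc' : (1 : ℝ) ≤ c := by exact_mod_cast hc
  calc (n : ℝ)
    _ ≤ b ^ (m * e) := hn
    _ = 2 ^ (Real.logb 2 b * (m * e : ℕ)) := by
      rw [Real.rpow_mul_natCast two_pos.le, Real.rpow_logb two_pos one_lt_two.ne' (by positivity)]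
    _ ≤ 2 ^ ((m : ℝ) * (c * e * Real.logb 2 b)) := by
      refine Real.rpow_le_rpow_of_exponent_le one_le_two ?_
      have hle := le_mul_of_one_le_left (show 0 ≤ (m : ℝ) * e * Real.logb 2 b by positivity) hc'
      push_cast
      linarith

end ODD

theorem theorem3p2_general (A : Type*) [Finite A] [Nonempty A] [LinearOrder A] (w : ℕ)
    (hw : 1 ≤ w) :
    (ODD.IsFunctional (ODD.canonization A w) ∧
      ODD.dom (ODD.canonization A w) = ODD.odds A w ∧
      ∃ n : ℕ, n ≤ 2 ^ (7 * (w * 2 ^ w)) ∧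
        ODD.IsRegularTransduction (ODD.layers A w) (ODD.cdLayers A (2 ^ w)) n
          (ODD.canonization A w)) ∧
    (ODD.IsFunctional (ODD.cdCanonization A w) ∧
      ODD.dom (ODD.cdCanonization A w) = ODD.cdOdds A w ∧
      ∃ n : ℕ, n ≤ max w 2 ^ (7 * w) ∧
        ODD.IsRegularTransduction (ODD.cdLayers A w) (ODD.cdLayers A w) n
          (ODD.cdCanonization A w)) := by
  refine ⟨⟨ODD.isFunctional_canonizationOn _, ODD.dom_canonizationOn _, _, ?_,
    ODD.isRegularTransduction_canonization w⟩, ODD.isFunctional_canonizationOn _,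
    ODD.dom_canonizationOn _, _, ODD.card_code_le hw le_rfl,
    ODD.isRegularTransduction_cdCanonization w⟩
  have hpow : 2 ≤ 2 ^ w := Nat.le_self_pow (Nat.one_le_iff_ne_zero.1 hw) 2
  have h := ODD.card_code_le (Nat.one_le_two_pow (n := w)) w.lt_two_pow_self.le
  rwa [max_eq_left hpow, ← pow_mul, Nat.mul_left_comm] at h

theorem theorem3p2 :
    ∃ c : ℕ, ∀ (A : Type*) [Fintype A] [Nonempty A] [LinearOrder A] (w : ℕ), 1 ≤ w →
      (ODD.IsFunctional (ODD.canonization A w) ∧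
        ODD.dom (ODD.canonization A w) = ODD.odds A w ∧
        ∃ n : ℕ, (n : ℝ) ≤ (2 : ℝ) ^ ((c : ℝ) * (Fintype.card A * w * 2 ^ w)) ∧
          ODD.IsRegularTransduction (ODD.layers A w) (ODD.cdLayers A (2 ^ w)) n
            (ODD.canonization A w)) ∧
      (ODD.IsFunctional (ODD.cdCanonization A w) ∧
        ODD.dom (ODD.cdCanonization A w) = ODD.cdOdds A w ∧
        ∃ n : ℕ,
          (n : ℝ) ≤ (2 : ℝ) ^ ((c : ℝ) * (Fintype.card A * w * Real.logb 2 (max (w : ℝ) 2))) ∧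
          ODD.IsRegularTransduction (ODD.cdLayers A w) (ODD.cdLayers A w) n
            (ODD.cdCanonization A w)) := by
  refine ⟨7, fun A _ _ _ w hw => ?_⟩
  obtain ⟨⟨hfun, hdom, n, hn, hreg⟩, hfun', hdom', m, hm, hreg'⟩ := theorem3p2_general A w hw
  refine ⟨⟨hfun, hdom, n, ?_, hreg⟩, hfun', hdom', m, ?_, hreg'⟩
  · simpa [mul_assoc] using ODD.natCast_le_two_rpow (Fintype.card_pos (α := A)) hn
  · exact ODD.natCast_le_two_rpow_logb Fintype.card_pos (le_max_of_le_right one_le_two)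
      (by exact_mod_cast hm)
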